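/- For an integer $k \ge 2$ let $\Sigma_k = \{0,1,\dots,k-1\}$, and for a word $w = a_1\cdots a_t \in \Sigma_k^*$ let $[w]_k = \sum_{i=1}^t a_i k^{t-i}$; for $L \subseteq \Sigma_k^*$ let $[L]_k = \{[w]_k : w \in L\}$. For a word $w = [a_1,b_1]\cdots[a_t,b_t]$ over $\Sigma_k^2 = \Sigma_k\times\Sigma_k$ let $\pi_1(w) = a_1\cdots a_t$, $\pi_2(w) = b_1\cdots b_t$ and, if $[\pi_2(w)]_k \neq 0$, $\mathrm{quo}_k(w) = [\pi_1(w)]_k/[\pi_2(w)]_k$. For $L \subseteq (\Sigma_k^2)^*$ say that $\mathrm{quo}_k(L)$ is defined if $[\pi_2(w)]_k \ne 0$ for all $w \in L$, and then put $\mathrm{quo}_k(L) = \{\mathrm{quo}_k(w) : w \in L\}$. There is an algorithm (a total computable function) that, given an integer $k\ge 2$ and a DFA $M_1$ over $\Sigma_k^2$ with language $L_1 = L(M_1)$, decides whether $\mathrm{quo}_k(L_1)$ is defined and satisfies $\mathrm{quo}_k(L_1) \subseteq \mathbb{N}$, and if so outputs a DFA $M_2$ over $\Sigma_k$ such that $[L(M_2)]_k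 = \mathrm{quo}_k(L_1)$. Consequently, there are algorithms that, given $k \ge 2$, a DFA over $\Sigma_k^2$ with language $L_1$ and a DFA over $\Sigma_k$ with language $L_2$, decide (a) whether $\mathrm{quo}_k(L_1)$ is defined and $\mathrm{quo}_k(L_1) \subseteq [L_2]_k$; (b) whether $\mathrm{quo}_k(L_1)$ is defined and $\mathrm{quo}_k(L_1) = [L_2]_k$. In particular there is an algorithm that decides, given $k\ge 2$ and a DFA over $\Sigma_k^2$ with language $L_1$, whether $\mathrm{quo}_k(L_1)$ is defined and $\mathrm{quo}_k(L_1) = \mathbb{N}$. -/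

import Mathlib

namespace AutomaticRationals

/-- The integer `[w]_k` that the word `w` over `Σ_k = {0, …, k-1}` represents in base `k`, most
significant digit first. (`Nat.ofDigits` reads the least significant digit first.) -/
def value (k : ℕ) (w : List (Fin k)) : ℕ :=
  Nat.ofDigits k (w.map (fun a => (a : ℕ))).reverse

/-- `[L]_k`, the set of natural numbers represented by a language over `Σ_k`. -/
def valueSet (k : ℕ) (L : Language (Fin k)) : Set ℕ :=
  {n | ∃ w ∈ L, value k w = n}

/-- The numerator `[π₁(w)]_k` of a word over `Σ_k²`. -/
def num (k : ℕ) (w : List (Fin k × Fin k)) : ℕ := value k (w.map Prod.fst)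

/-- The denominator `[π₂(w)]_k` of a word over `Σ_k²`. -/
def den (k : ℕ) (w : List (Fin k × Fin k)) : ℕ := value k (w.map Prod.snd)

/-- `quo_k(w)`; meaningful only if `den k w ≠ 0`. -/
def quo (k : ℕ) (w : List (Fin k × Fin k)) : ℚ := (num k w : ℚ) / (den k w : ℚ)

/-- `quo_k(L)` is defined: no word of `L` has denominator `0`. -/
def QuoDefined (k : ℕ) (L : Language (Fin k × Fin k)) : Prop :=
  ∀ w ∈ L, den k w ≠ 0

/-- The set of rationals `quo_k(L)`; meaningful only under `QuoDefined k L`. -/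
def quoSet (k : ℕ) (L : Language (Fin k × Fin k)) : Set ℚ :=
  {x | ∃ w ∈ L, quo k w = x}

/-- A set of natural numbers, viewed as a set of rationals. -/
def natsInRat (S : Set ℕ) : Set ℚ := (fun n : ℕ => (n : ℚ)) '' S

/-- A finite description of a deterministic finite automaton, used as input and output of
algorithms. The states are `0, …, size`; `table` lists, for each state, the successor states for
the letters with index `0, 1, 2, …`; `accept` lists the accepting states. Missing table entries
are read as `0` and state numbers are read modulo `size + 1`, so every description denotes a
complete automaton. -/
structure DFACode where
  size : ℕ
  start : ℕ
  table : List (List ℕ)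
  accept : List ℕ

namespace DFACode

def equivProd : DFACode ≃ ℕ × ℕ × List (List ℕ) × List ℕ where
  toFun c := (c.size, c.start, c.table, c.accept)
  invFun p := ⟨p.1, p.2.1, p.2.2.1, p.2.2.2⟩
  left_inv _ := rfl
  right_inv _ := rfl

instance : Primcodable DFACode := Primcodable.ofEquiv _ equivProd

/-- The automaton denoted by a description, over an alphabet whose letters are numbered by
`index`. -/
def toDFA {α : Type} (index : α → ℕ) (c : DFACode) : DFA α (Fin (c.size + 1)) where
  step q a := Fin.ofNat (c.size + 1) ((c.table.getD q []).getD (index a) 0)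
  start := Fin.ofNat (c.size + 1) c.start
  accept := {q | (q : ℕ) ∈ c.accept}

/-- The language over `Σ_k` accepted by the automaton. -/
def lang (k : ℕ) (c : DFACode) : Language (Fin k) :=
  (c.toDFA (fun a : Fin k => (a : ℕ))).accepts

/-- The language over `Σ_k²` accepted by the automaton; the letter `[a, b]` has index
`a * k + b`. -/
def langPair (k : ℕ) (c : DFACode) : Language (Fin k × Fin k) :=
  (c.toDFA (fun a : Fin k × Fin k => (a.1 : ℕ) * k + a.2)).accepts

/-- Every deterministic finite automaton over a finite alphabet has a description. -/
theorem exists_accepts_eq {α σ : Type} [Finite α] [Finite σ] (index : α → ℕ)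
    (hi : Function.Injective index) (M : DFA α σ) :
    ∃ c : DFACode, (c.toDFA index).accepts = M.accepts := by
  classical
  obtain ⟨n, ⟨e⟩⟩ := Finite.exists_equiv_fin σ
  obtain ⟨n, rfl⟩ : ∃ m, n = m + 1 :=
    Nat.exists_eq_succ_of_ne_zero (by rintro rfl; exact (e M.start).elim0)
  obtain ⟨B, hB⟩ := (Set.finite_range index).bddAbove
  let row : Fin (n + 1) → List ℕ := fun q => List.ofFn (fun i : Fin (B + 1) =>
    if h : ∃ a, index a = i then ((e (M.step (e.symm q) h.choose) : Fin (n + 1)) : ℕ) else 0)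
  let c : DFACode := ⟨n, e M.start, List.ofFn row,
    ((Finset.univ.filter fun q : Fin (n + 1) => e.symm q ∈ M.accept).toList).map Fin.val⟩
  have hstep : ∀ (q : σ) (a : α), (c.toDFA index).step (e q) a = e (M.step q a) := by
    intro q a
    have ha : index a < B + 1 := Nat.lt_succ_of_le (hB ⟨a, rfl⟩)
    have hex : ∃ b, index b = index a := ⟨a, rfl⟩
    have hch : hex.choose = a := hi hex.choose_spec
    have h1 : (List.ofFn row).getD (e q) [] = row (e q) := by
      simp [List.getD_eq_getElem?_getD, List.getElem?_ofFn, -List.ofFn_succ,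
        Nat.le_of_lt_succ (e q).isLt]
    have h2 : (row (e q)).getD (index a) 0 = (e (M.step q a) : ℕ) := by
      simp only [row, List.getD_eq_getElem?_getD, List.getElem?_ofFn, ha, dif_pos,
        Option.getD_some, Equiv.symm_apply_apply]
      rw [dif_pos hex, hch]
    change Fin.ofNat (n + 1) (((List.ofFn row).getD (e q) []).getD (index a) 0) = _
    rw [h1, h2]
    simp
  have heval : ∀ (w : List α) (q : σ),
      (c.toDFA index).evalFrom (e q) w = e (M.evalFrom q w) := by
    intro w
    induction w with
    | nil => intro q; rfl
    | cons a w ih => intro q; simp only [DFA.evalFrom_cons, hstep, ih]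
  have hstart : (c.toDFA index).start = e M.start := by
    change Fin.ofNat (n + 1) (e M.start : ℕ) = _
    simp
  refine ⟨c, ?_⟩
  ext w
  rw [DFA.mem_accepts, DFA.mem_accepts, DFA.eval, DFA.eval, hstart, heval]
  change ((e (M.evalFrom M.start w) : Fin (n + 1)) : ℕ) ∈
    ((Finset.univ.filter fun q : Fin (n + 1) => e.symm q ∈ M.accept).toList).map Fin.val ↔ _
  rw [List.mem_map_of_injective Fin.val_injective]
  simp

end DFACode

end AutomaticRationals

namespace AutomaticRationals

/-! Divisibility of the numerator by the denominator is not a regular property, so integrality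
cannot be read off a product automaton. Pumping replaces it by a regular property.

Suppose all quotients are integers and a loop `v` is inserted repeatedly into an accepted word, with
a nonzero denominator by the end of its first copy. Numerators and denominators of `u v^i y` satisfy
affine recurrences with the same ratio `k^|v|`, and the quotients are bounded integers, so they are
constant (`mul_eq_mul_of_affine_recurrence`). Deleting loops therefore shows that every quotient is
attained with denominator below `k^n`, where `n` is the number of states (`exists_den_lt_of_dvd`).
If instead a loop occurs while the denominator is still zero and the numerator is not, the numerator
can be made large independently of the denominator, and this forces the denominator to be `d * k^j`
with `d < k^n` (`exists_den_eq_mul_pow`). So integrality yields `BoundedDvd` for every accepted word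
(`boundedDvd_of_dvd`). Conversely `BoundedDvd` implies divisibility, and it is decided by a finite
right congruence, so checking words of bounded length suffices (`boundedDvd_of_short`).

Once integrality holds, the quotients form `smallQuo`, where only finitely many denominators occur.
Reading `N` digit by digit and comparing it with the numerator keeps a bounded carry, so `profile`
is a finite right congruence. It gives an automaton for the quotients by Myhill–Nerode, and a bound
below which any discrepancy with a value set shows up. All tests thus become bounded
quantifications, which are primitive recursive. The output automaton is found by searching the
descriptions with the equality test; the search stops because a suitable automaton exists. -/

theorem exists_lt_length_of_congruence {α β : Type*} (φ : List α → β) (S : Finset β)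
    (hS : ∀ w, φ w ∈ S) (hφ : ∀ w w' a, φ w = φ w' → φ (w ++ [a]) = φ (w' ++ [a]))
    (P : List α → Prop) (hP : ∀ w w', φ w = φ w' → P w → P w') (h : ∃ w, P w) :
    ∃ w, w.length < S.card ∧ P w := by
  classical
  have happ : ∀ y w w', φ w = φ w' → φ (w ++ y) = φ (w' ++ y) := by
    intro y
    induction y with
    | nil => intro w w' h; simpa using h
    | cons a y ih =>
      intro w w' h
      have := ih _ _ (hφ w w' a h)
      simpa using this
  have key : ∀ m, ∀ w : List α, w.length = m → P w → ∃ w, w.length < S.card ∧ P w := by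
    intro m
    induction m using Nat.strong_induction_on with
    | _ m ih =>
      intro w hw hPw
      by_cases hlt : w.length < S.card
      · exact ⟨w, hlt, hPw⟩
      -- Two of the first `S.card + 1` prefixes share their `φ`-value; the factor between them can
      -- be cut out without changing `φ` of the whole word.
      obtain ⟨i, hi, j, hj, hij, heq⟩ := Finset.exists_ne_map_eq_of_card_lt_of_maps_to
        (s := Finset.range (S.card + 1)) (t := S) (f := fun i => φ (w.take i)) (by simp)
        (fun i _ => hS _)
      wlog hlt' : i < j generalizing i j
      · exact this j hj i hi hij.symm heq.symm (by omega)
      simp only [Finset.mem_range] at hi hj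
      refine ih (w.take i ++ w.drop j).length ?_ _ rfl ?_
      · simp; omega
      · refine hP w _ ?_ hPw
        have := happ (w.drop j) _ _ heq
        simp only [List.take_append_drop] at this
        exact this.symm
  obtain ⟨w, hw⟩ := h
  exact key _ w rfl hw

/-! ### Base-`k` values of words and of powers of words -/

section Words

variable {k : ℕ}

@[simp] theorem value_nil : value k [] = 0 := rfl

theorem value_append (u v : List (Fin k)) :
    value k (u ++ v) = value k u * k ^ v.length + value k v := by
  simp [value, Nat.ofDigits_append]
  ring

theorem value_concat (u : List (Fin k)) (a : Fin k) :
    value k (u ++ [a]) = k * value k u + a := by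
  rw [value_append]
  simp [value, mul_comm]

theorem value_lt (hk : 2 ≤ k) (u : List (Fin k)) : value k u < k ^ u.length := by
  have := Nat.ofDigits_lt_base_pow_length (b := k) (l := (u.map (fun a => (a : ℕ))).reverse)
    (by omega) (by simp; intro x a _ h; exact h ▸ a.isLt)
  simpa [value] using this

theorem exists_value_eq (hk : 2 ≤ k) (l p : ℕ) (hp : p < k ^ l) :
    ∃ u : List (Fin k), u.length = l ∧ value k u = p := by
  induction l generalizing p with
  | zero => exact ⟨[], rfl, by simp at hp; simp [hp]⟩
  | succ l ih =>
    obtain ⟨u, hu, hv⟩ := ih (p / k) (by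
      rw [Nat.div_lt_iff_lt_mul (by omega)]; rwa [pow_succ] at hp)
    refine ⟨u ++ [⟨p % k, Nat.mod_lt _ (by omega)⟩], by simp [hu], ?_⟩
    rw [value_concat, hv]
    exact Nat.div_add_mod p k

@[simp] theorem num_nil : num k [] = 0 := rfl
@[simp] theorem den_nil : den k [] = 0 := rfl

theorem num_append (u v : List (Fin k × Fin k)) :
    num k (u ++ v) = num k u * k ^ v.length + num k v := by
  simp [num, value_append]

theorem den_append (u v : List (Fin k × Fin k)) :
    den k (u ++ v) = den k u * k ^ v.length + den k v := by
  simp [den, value_append]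

theorem num_concat (u : List (Fin k × Fin k)) (a : Fin k × Fin k) :
    num k (u ++ [a]) = k * num k u + a.1 := by
  simp [num, value_concat]

theorem den_concat (u : List (Fin k × Fin k)) (a : Fin k × Fin k) :
    den k (u ++ [a]) = k * den k u + a.2 := by
  simp [den, value_concat]

theorem num_lt (hk : 2 ≤ k) (u : List (Fin k × Fin k)) : num k u < k ^ u.length := by
  simpa [num] using value_lt hk (u.map Prod.fst)

theorem den_lt (hk : 2 ≤ k) (u : List (Fin k × Fin k)) : den k u < k ^ u.length := by
  simpa [den] using value_lt hk (u.map Prod.snd)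

theorem exists_num_den_eq (hk : 2 ≤ k) (l p q : ℕ) (hp : p < k ^ l) (hq : q < k ^ l) :
    ∃ w : List (Fin k × Fin k), w.length = l ∧ num k w = p ∧ den k w = q := by
  obtain ⟨u, hu, rfl⟩ := exists_value_eq hk l p hp
  obtain ⟨v, hv, rfl⟩ := exists_value_eq hk l q hq
  refine ⟨u.zip v, by simp [hu, hv], ?_, ?_⟩
  · rw [num, List.map_fst_zip (by omega)]
  · rw [den, List.map_snd_zip (by omega)]

/-- The word `v ^ i`. -/
def wordPow {α : Type*} (v : List α) (i : ℕ) : List α := (List.replicate i v).flatten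

@[simp] theorem wordPow_zero {α : Type*} (v : List α) : wordPow v 0 = [] := rfl

theorem wordPow_succ {α : Type*} (v : List α) (i : ℕ) : wordPow v (i + 1) = v ++ wordPow v i := rfl

theorem wordPow_succ' {α : Type*} (v : List α) (i : ℕ) :
    wordPow v (i + 1) = wordPow v i ++ v := by
  simp [wordPow, List.replicate_succ']

theorem map_wordPow {α β : Type*} (f : α → β) (v : List α) (i : ℕ) :
    (wordPow v i).map f = wordPow (v.map f) i := by
  simp [wordPow]

theorem evalFrom_wordPow {α σ : Type*} (M : DFA α σ) (s : σ) (v : List α)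
    (h : M.evalFrom s v = s) (i : ℕ) : M.evalFrom s (wordPow v i) = s := by
  induction i with
  | zero => rfl
  | succ i ih => rw [wordPow_succ, DFA.evalFrom_of_append, h, ih]

theorem lt_value_append_wordPow (hk : 2 ≤ k) (u v : List (Fin k)) (hv : v ≠ [])
    (h : 0 < value k (u ++ v)) (i : ℕ) : i < value k (u ++ wordPow v (i + 1)) := by
  induction i with
  | zero => simpa [wordPow_succ] using h
  | succ i ih =>
    rw [wordPow_succ', ← List.append_assoc, value_append]
    have h1 : 2 ≤ k ^ v.length :=
      hk.trans (Nat.le_self_pow (by simpa using hv) k)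
    nlinarith

theorem lt_num_append_wordPow (hk : 2 ≤ k) (u v : List (Fin k × Fin k)) (hv : v ≠ [])
    (h : 0 < num k (u ++ v)) (i : ℕ) : i < num k (u ++ wordPow v (i + 1)) := by
  simp only [num, List.map_append, map_wordPow] at h ⊢
  exact lt_value_append_wordPow hk _ _ (by simpa using hv) h i

theorem lt_den_append_wordPow (hk : 2 ≤ k) (u v : List (Fin k × Fin k)) (hv : v ≠ [])
    (h : 0 < den k (u ++ v)) (i : ℕ) : i < den k (u ++ wordPow v (i + 1)) := by
  simp only [den, List.map_append, map_wordPow] at h ⊢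
  exact lt_value_append_wordPow hk _ _ (by simpa using hv) h i

end Words

/-! ### Quotients along a pumped loop -/

/-- Two sequences that satisfy affine recurrences with the same ratio and whose quotients are
bounded integers have constant quotient. -/
theorem mul_eq_mul_of_affine_recurrence (p q : ℕ → ℤ) (K e b B : ℤ) (hK : K ≠ 0)
    (hp : ∀ i, p (i + 1) = K * p i - e) (hq : ∀ i, q (i + 1) = K * q i - b)
    (hdvd : ∀ i, q i ∣ p i) (hB : ∀ i, |p (i + 1)| ≤ B * q (i + 1))
    (hgrow : ∀ i : ℕ, (i : ℤ) < q (i + 1)) : p 0 * q 1 = p 1 * q 0 := by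
  choose N hN using hdvd
  have hNB : ∀ i, |N (i + 1)| ≤ B := by
    intro i
    have h0 : 0 < q (i + 1) := by have := hgrow i; omega
    have := hB i
    rw [hN, abs_mul, abs_of_pos h0, mul_comm] at this
    exact le_of_mul_le_mul_right this h0
  -- The right side stays bounded while `q` grows without bound, so it vanishes for a large index.
  have hdiff : ∀ i, (N (i + 2) - N (i + 1)) * q (i + 2) = N (i + 1) * b - e := by
    intro i
    have h1 := hp (i + 1)
    have h2 := hq (i + 1)
    rw [hN (i + 1 + 1), hN (i + 1)] at h1
    have h3 : K * q (i + 1) = q (i + 2) + b := by rw [h2]; ring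
    linear_combination h1 + N (i + 1) * h3
  obtain ⟨I, hI⟩ : ∃ I : ℕ, B * |b| + |e| ≤ I :=
    ⟨(B * |b| + |e|).toNat, Int.self_le_toNat _⟩
  have hzero : N (I + 1) * b - e = 0 := by
    have hq2 := hgrow (I + 1)
    refine Int.eq_zero_of_abs_lt_dvd (Dvd.intro_left _ (hdiff I)) ?_
    have h1 : |N (I + 1) * b - e| ≤ |N (I + 1)| * |b| + |e| := by
      rw [← abs_mul]; exact abs_sub _ _
    have h2 : |N (I + 1)| * |b| ≤ B * |b| := mul_le_mul_of_nonneg_right (hNB I) (abs_nonneg _)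
    push_cast at hq2
    have : q (I + 1 + 1) = q (I + 2) := rfl
    linarith
  -- With `N (I + 1) * b = e` the recurrences preserve `p = N (I + 1) * q`, and since `K ≠ 0` they
  -- can be run backwards to index `0`.
  have hback : ∀ d j, j + d = I + 1 → p j = N (I + 1) * q j := by
    intro d
    induction d with
    | zero => rintro j rfl; rw [hN]; ring
    | succ d ih =>
      intro j hj
      have := ih (j + 1) (by omega)
      rw [hp, hq] at this
      exact mul_left_cancel₀ hK (by linear_combination this - hzero)
  rw [hback (I + 1) 0 (by omega), hback I 1 (by omega)]
  ring

/-- Pumping turns both components into affine sequences of ratio `k^|v|`. The quotients are bounded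
by `k^|uv|`, because the denominator is already nonzero after `u v`. The conclusion is
cross-multiplied equality of the quotients without and with one copy of the loop. -/
theorem num_mul_den_eq_of_pump {k : ℕ} (hk : 2 ≤ k) (u v y : List (Fin k × Fin k)) (hv : v ≠ [])
    (hd : 0 < den k (u ++ v))
    (hint : ∀ i, den k (u ++ wordPow v i ++ y) ∣ num k (u ++ wordPow v i ++ y)) :
    num k (u ++ y) * den k (u ++ v ++ y) = num k (u ++ v ++ y) * den k (u ++ y) := by
  have := mul_eq_mul_of_affine_recurrence
    (fun i => (num k (u ++ wordPow v i ++ y) : ℤ)) (fun i => (den k (u ++ wordPow v i ++ y) : ℤ))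
    (k ^ v.length : ℤ) (k ^ v.length * num k y - num k (v ++ y))
    (k ^ v.length * den k y - den k (v ++ y)) (k ^ (u ++ v).length)
    (by positivity) ?_ ?_ ?_ ?_ ?_
  · simpa [wordPow_succ] using (by exact_mod_cast this :
      num k (u ++ wordPow v 0 ++ y) * den k (u ++ wordPow v 1 ++ y) =
        num k (u ++ wordPow v 1 ++ y) * den k (u ++ wordPow v 0 ++ y))
  · intro i
    simp only [wordPow_succ', num_append, List.length_append]
    push_cast
    ring
  · intro i
    simp only [wordPow_succ', den_append, List.length_append]
    push_cast
    ring
  · intro i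
    exact_mod_cast hint i
  · intro i
    rw [abs_of_nonneg (by positivity)]
    have h1 := num_lt hk (u ++ wordPow v (i + 1) ++ y)
    have h2 : k ^ (wordPow v i ++ y).length ≤ den k (u ++ wordPow v (i + 1) ++ y) := by
      rw [wordPow_succ, ← List.append_assoc, List.append_assoc (u ++ v), den_append (u ++ v)]
      nlinarith [Nat.zero_le (den k (wordPow v i ++ y)),
        Nat.zero_le (k ^ (wordPow v i ++ y).length)]
    have h3 : (u ++ wordPow v (i + 1) ++ y).length =
        (u ++ v).length + (wordPow v i ++ y).length := by
      simp only [wordPow_succ, List.length_append]; omega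
    rw [h3, pow_add] at h1
    have h4 := h1.le.trans (Nat.mul_le_mul_left _ h2)
    exact_mod_cast h4
  · intro i
    have h1 := lt_den_append_wordPow hk u v hv hd i
    have h2 : den k (u ++ wordPow v (i + 1)) ≤ den k (u ++ wordPow v (i + 1) ++ y) := by
      rw [den_append _ y]
      have : 1 ≤ k ^ y.length := Nat.one_le_pow _ _ (by omega)
      nlinarith
    exact_mod_cast h1.trans_le h2

theorem pump_mem_accepts {k : ℕ} {σ : Type*} (M : DFA (Fin k × Fin k) σ)
    (u v y : List (Fin k × Fin k))
    (hloop : M.evalFrom (M.eval u) v = M.eval u) (h : u ++ y ∈ M.accepts) (i : ℕ) :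
    u ++ wordPow v i ++ y ∈ M.accepts := by
  rw [DFA.mem_accepts, DFA.eval] at h ⊢
  rw [DFA.evalFrom_of_append] at h
  rw [DFA.evalFrom_of_append, DFA.evalFrom_of_append]
  have := evalFrom_wordPow M (M.eval u) v hloop i
  rw [DFA.eval] at this
  rwa [this]

/-! ### Shrinking denominators under integrality -/

section Pumping

variable {k : ℕ} {σ : Type*} [Fintype σ] (M : DFA (Fin k × Fin k) σ)

theorem exists_pump_of_le_den (hk : 2 ≤ k) (s : σ) (w : List (Fin k × Fin k))
    (h : k ^ Fintype.card σ ≤ den k w) :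
    ∃ u v y, w = u ++ v ++ y ∧ v ≠ [] ∧ 0 < den k u ∧
      M.evalFrom (M.evalFrom s u) v = M.evalFrom s u := by
  set n := Fintype.card σ
  have hlen : n < w.length :=
    (Nat.pow_lt_pow_iff_right (by omega : 1 < k)).1 (h.trans_lt (den_lt hk w))
  -- Only the last `n` letters are searched for a loop: the prefix before them has nonzero
  -- denominator because the total is at least `k^n`.
  obtain ⟨x, z, hw, hz⟩ : ∃ x z, w = x ++ z ∧ z.length = n :=
    ⟨w.take (w.length - n), w.drop (w.length - n), by simp, by simp; omega⟩
  obtain ⟨t, a, b, c, hx, -, hb, ha, hloop, -⟩ :=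
    M.evalFrom_split (x := z) (s := M.evalFrom s x) (by omega) rfl
  have hden : 0 < den k x := by
    by_contra h0
    have h1 := den_lt hk z
    rw [hw, den_append, hz] at h
    have : den k x = 0 := by omega
    rw [hz] at h1
    simp [this] at h
    omega
  refine ⟨x ++ a, b, c, by simp [hw, hx], hb, ?_, ?_⟩
  · rw [den_append]
    have : 0 < den k x * k ^ a.length := Nat.mul_pos hden (Nat.pow_pos (by omega))
    omega
  · rw [DFA.evalFrom_of_append, ha, hloop]

/-- While the denominator is at least `k^n`, a loop behind its leading digit can be deleted without
changing the quotient. -/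
theorem exists_den_lt_of_dvd (hk : 2 ≤ k)
    (hM : ∀ w ∈ M.accepts, den k w ≠ 0 ∧ den k w ∣ num k w) (w : List (Fin k × Fin k))
    (hw : w ∈ M.accepts) :
    ∃ w' ∈ M.accepts, den k w' < k ^ Fintype.card σ ∧
      num k w' * den k w = num k w * den k w' := by
  induction hl : w.length using Nat.strong_induction_on generalizing w with
  | _ l ih =>
    subst hl
    by_cases hlt : den k w < k ^ Fintype.card σ
    · exact ⟨w, hw, hlt, rfl⟩
    obtain ⟨u, v, y, rfl, hv, hu, hloop⟩ := exists_pump_of_le_den M hk M.start w (by omega)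
    have hmem : u ++ y ∈ M.accepts := by
      rw [DFA.mem_accepts, DFA.eval, DFA.evalFrom_of_append, DFA.evalFrom_of_append, hloop] at hw
      rwa [DFA.mem_accepts, DFA.eval, DFA.evalFrom_of_append]
    have hpow := pump_mem_accepts M u v y hloop hmem
    have hcross := num_mul_den_eq_of_pump hk u v y hv
      (by rw [den_append]
          have : 0 < den k u * k ^ v.length := Nat.mul_pos hu (Nat.pow_pos (by omega))
          omega)
      (fun i => (hM _ (hpow i)).2)
    obtain ⟨w', hw', hlt', heq⟩ := ih (u ++ y).length
      (by have := List.length_pos_of_ne_nil hv; simp; omega) (u ++ y) hmem rfl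
    refine ⟨w', hw', hlt', ?_⟩
    have h0 : den k (u ++ y) ≠ 0 := (hM _ hmem).1
    refine Nat.eq_of_mul_eq_mul_right (Nat.pos_of_ne_zero h0) ?_
    calc num k w' * den k (u ++ v ++ y) * den k (u ++ y)
        = (num k w' * den k (u ++ y)) * den k (u ++ v ++ y) := by ring
      _ = (num k (u ++ y) * den k (u ++ v ++ y)) * den k w' := by rw [heq]; ring
      _ = num k (u ++ v ++ y) * den k w' * den k (u ++ y) := by rw [hcross]; ring

/-- Inserting copies of `v` enlarges the numerator at will and leaves the denominator alone.
Comparing with a second loop `v'`, found inside a large denominator, shows that deleting `v'`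
divides the denominator exactly by `k^|v'|`. Repeating this leaves a factor below `k^n`. -/
theorem exists_den_eq_mul_pow (hk : 2 ≤ k)
    (hM : ∀ w ∈ M.accepts, den k w ≠ 0 ∧ den k w ∣ num k w) (u v : List (Fin k × Fin k))
    (hv : v ≠ []) (hloop : M.evalFrom (M.eval u) v = M.eval u) (hden : den k (u ++ v) = 0)
    (hnum : 0 < num k (u ++ v)) (y : List (Fin k × Fin k)) (hy : u ++ y ∈ M.accepts) :
    ∃ d < k ^ Fintype.card σ, ∃ j, den k y = d * k ^ j := by
  have hden0 : ∀ i z, den k (u ++ wordPow v i ++ z) = den k z := by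
    have h1 : den k u = 0 ∧ den k v = 0 := by
      rw [den_append] at hden
      have : k ^ v.length ≠ 0 := by positivity
      simp_all
    have h2 : ∀ i, den k (wordPow v i) = 0 := by
      intro i
      induction i with
      | zero => rfl
      | succ i ih => rw [wordPow_succ, den_append, h1.2, ih]; simp
    intro i z
    rw [den_append, den_append, h1.1, h2]; simp
  induction hl : y.length using Nat.strong_induction_on generalizing y with
  | _ l ih =>
    subst hl
    by_cases hlt : den k y < k ^ Fintype.card σ
    · exact ⟨den k y, hlt, 0, by simp⟩
    obtain ⟨u', v', y', rfl, hv', hu', hloop'⟩ :=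
      exists_pump_of_le_den M hk (M.eval u) y (by omega)
    have hmem : u ++ (u' ++ y') ∈ M.accepts := by
      rw [DFA.mem_accepts, DFA.eval] at hy ⊢
      simp only [DFA.evalFrom_of_append] at hy ⊢
      rw [DFA.eval] at hloop'
      rwa [hloop'] at hy
    have hxloop : ∀ i, M.eval (u ++ wordPow v i ++ u') = M.evalFrom (M.eval u) u' := by
      intro i
      have := evalFrom_wordPow M (M.eval u) v hloop i
      simp only [DFA.eval] at this ⊢
      rw [DFA.evalFrom_of_append, DFA.evalFrom_of_append, this]
    have hcross : ∀ i, num k (u ++ wordPow v i ++ u' ++ y') * den k (u' ++ v' ++ y') =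
        num k (u ++ wordPow v i ++ u' ++ v' ++ y') * den k (u' ++ y') := by
      intro i
      have h1 := hden0 i (u' ++ y')
      have h2 := hden0 i (u' ++ v' ++ y')
      have h3 := num_mul_den_eq_of_pump hk (u ++ wordPow v i ++ u') v' y' hv' ?_ ?_
      · simp only [List.append_assoc] at h1 h2 h3 ⊢
        rwa [h1, h2] at h3
      · rw [List.append_assoc, hden0, den_append]
        have : 0 < den k u' * k ^ v'.length := Nat.mul_pos hu' (Nat.pow_pos (by omega))
        omega
      · intro j
        refine (hM _ (pump_mem_accepts M _ v' y' ?_ ?_ j)).2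
        · rw [hxloop, hloop']
        · have := pump_mem_accepts M u v _ hloop hmem i
          simpa using this
    have hmain : den k (u' ++ v' ++ y') = k ^ v'.length * den k (u' ++ y') := by
      -- Invariance of the quotient reads `P * q₁ = (K * P + E) * q₀` with `K = k^|v'|`, where `E`,
      -- `q₀`, `q₁` do not depend on the number of copies of `v`. The choice of `i` makes `P` exceed
      -- `|E * q₀|`, so both sides of `P * (q₁ - K * q₀) = E * q₀` vanish.
      set E : ℤ := (num k (v' ++ y') : ℤ) - k ^ v'.length * num k y'
      set q₀ := den k (u' ++ y')
      set q₁ := den k (u' ++ v' ++ y')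
      set i := (E * q₀).natAbs with hi
      have h1 := hcross (i + 1)
      set P := num k (u ++ wordPow v (i + 1) ++ u' ++ y') with hP
      have hPgt : i < P := by
        refine (lt_num_append_wordPow hk u v hv hnum i).trans_le ?_
        rw [hP, List.append_assoc, num_append _ (u' ++ y')]
        exact (Nat.le_mul_of_pos_right _ (Nat.pow_pos (by omega))).trans (Nat.le_add_right _ _)
      have h2 : (num k (u ++ wordPow v (i + 1) ++ u' ++ v' ++ y') : ℤ) =
          k ^ v'.length * P + E := by
        simp only [E, hP, num_append _ y', num_append _ v']
        push_cast
        ring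
      have h3 : (P : ℤ) * (q₁ - k ^ v'.length * q₀) = E * q₀ := by
        have : (P : ℤ) * q₁ = (k ^ v'.length * P + E) * q₀ := by
          rw [← h2]; exact_mod_cast h1
        linear_combination this
      have h4 : E * q₀ = 0 := by
        refine Int.eq_zero_of_abs_lt_dvd (Dvd.intro _ h3) ?_
        rw [Int.abs_eq_natAbs]
        exact_mod_cast hPgt
      rw [h4, mul_eq_zero] at h3
      have h5 : (q₁ : ℤ) - k ^ v'.length * q₀ = 0 := by
        rcases h3 with h | h
        · have : P = 0 := by exact_mod_cast h
          omega
        · exact h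
      have h6 : (q₁ : ℤ) = k ^ v'.length * q₀ := by linarith
      exact_mod_cast h6
    obtain ⟨d, hd, j, hj⟩ := ih (u' ++ y').length
      (by have := List.length_pos_of_ne_nil hv'; simp; omega) (u' ++ y') hmem rfl
    exact ⟨d, hd, v'.length + j, by rw [hmain, hj, pow_add]; ring⟩

end Pumping

/-! ### Integrality as a regular condition -/

/-- A sufficient condition for `q ∣ p`, which is recognizable by a finite automaton for fixed `C`:
the quotient is less than `C`, or `q` is a power of `k` times a number less than `C`. -/
def BoundedDvd (k C p q : ℕ) : Prop :=
  q ≠ 0 ∧ q ∣ p ∧ (p < C * q ∨ ∃ d < C, ∃ j, q = d * k ^ j)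

/-- If the quotient is at least `k^(n+1)`, the numerator starts more than `n` letters before the
denominator does. A loop then fits in between, and `exists_den_eq_mul_pow` applies. -/
theorem boundedDvd_of_dvd {k : ℕ} {σ : Type*} [Fintype σ] (M : DFA (Fin k × Fin k) σ) (hk : 2 ≤ k)
    (hM : ∀ w ∈ M.accepts, den k w ≠ 0 ∧ den k w ∣ num k w) (w : List (Fin k × Fin k))
    (hw : w ∈ M.accepts) : BoundedDvd k (k ^ (Fintype.card σ + 1)) (num k w) (den k w) := by
  refine ⟨(hM w hw).1, (hM w hw).2, ?_⟩
  by_contra! hcon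
  obtain ⟨hbig, hform⟩ := hcon
  set n := Fintype.card σ with hn
  set q := den k w with hq
  have hq0 : q ≠ 0 := (hM w hw).1
  set a := Nat.log k q
  have ha : k ^ a ≤ q := Nat.pow_log_le_self k hq0
  have ha' : q < k ^ (a + 1) := Nat.lt_pow_succ_log_self (by omega) q
  have hp : k ^ (n + a + 1) ≤ num k w := by
    refine le_trans ?_ hbig
    calc k ^ (n + a + 1) = k ^ (n + 1) * k ^ a := by rw [← pow_add]; congr 1; omega
      _ ≤ _ := Nat.mul_le_mul_left _ ha
  have hlen : n + a + 1 < w.length :=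
    (Nat.pow_lt_pow_iff_right (by omega : 1 < k)).1 (hp.trans_lt (num_lt hk w))
  -- The block `y` of length `a + 1` holds all digits of `q`, and `z` gives room for a loop that is
  -- read after the numerator has become nonzero and before the denominator does.
  obtain ⟨x, z, y, hxzy, hz, hy⟩ : ∃ x z y, w = x ++ z ++ y ∧ z.length = n ∧ y.length = a + 1 := by
    refine ⟨w.take (w.length - (n + a + 1)), (w.drop (w.length - (n + a + 1))).take n,
      (w.drop (w.length - (n + a + 1))).drop n, ?_, ?_, ?_⟩
    · simp only [List.append_assoc, List.take_append_drop]
    · simp; omega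
    · simp; omega
  have hxnum : 0 < num k x := by
    by_contra h0
    have h1 := num_lt hk (z ++ y)
    rw [hxzy, List.append_assoc, num_append] at hp
    have : num k x = 0 := by omega
    rw [List.length_append, hz, hy, ← add_assoc] at h1
    simp [this] at hp
    omega
  have hxz : den k (x ++ z) = 0 := by
    by_contra h0
    rw [hxzy, den_append, hy] at hq
    have : k ^ (a + 1) ≤ den k (x ++ z) * k ^ (a + 1) :=
      Nat.le_mul_of_pos_left _ (Nat.pos_of_ne_zero h0)
    omega
  obtain ⟨t, b, v, c, hzs, -, hv, hb, hloop, -⟩ :=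
    M.evalFrom_split (x := z) (s := M.eval x) (by omega) rfl
  have hpow : ∀ m, 0 < k ^ m := fun m => Nat.pow_pos (by omega)
  have hden0 : den k (x ++ b ++ v) = 0 := by
    rw [hzs, ← List.append_assoc, ← List.append_assoc, den_append _ c] at hxz
    have := Nat.le_mul_of_pos_right (den k (x ++ b ++ v)) (hpow c.length)
    omega
  have hnum0 : 0 < num k (x ++ b ++ v) := by
    rw [List.append_assoc, num_append]
    have := Nat.mul_pos hxnum (hpow (b ++ v).length)
    omega
  have heq : w = (x ++ b) ++ (v ++ c ++ y) := by simp [hxzy, hzs]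
  obtain ⟨d, hd, j, hj⟩ := exists_den_eq_mul_pow M hk hM (x ++ b) v hv
    (by rw [DFA.eval, DFA.evalFrom_of_append, ← DFA.eval, hb, hloop]) hden0 hnum0 (v ++ c ++ y)
    (by rwa [← heq])
  refine hform d (hd.trans_le (Nat.pow_le_pow_right (by omega) (by omega))) j ?_
  rw [← hj, hq, heq, den_append]
  have : den k (x ++ b) = 0 := by
    rw [den_append _ v] at hden0
    have := Nat.le_mul_of_pos_right (den k (x ++ b)) (hpow v.length)
    omega
  rw [this]; simp

/-! ### Short witnesses from finite congruences -/

open Finset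

theorem min_mul_add_congr {k x y m : ℕ} (c : ℕ) (hk : 2 ≤ k) (h : min x m = min y m) :
    min (k * x + c) m = min (k * y + c) m := by
  rcases eq_or_ne x y with rfl | hne
  · rfl
  have hx : m ≤ x := by omega
  have hy : m ≤ y := by omega
  have h1 : m ≤ k * x + c := by nlinarith
  have h2 : m ≤ k * y + c := by nlinarith
  rw [min_eq_right h1, min_eq_right h2]

/-- The congruence records the state and the value truncated at `N + 1`, which has `N + 2`
possibilities. -/
theorem exists_short_value_eq {k : ℕ} {σ : Type*} [Fintype σ] (M : DFA (Fin k) σ) (hk : 2 ≤ k)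
    (N : ℕ) (h : ∃ x ∈ M.accepts, value k x = N) :
    ∃ x ∈ M.accepts, x.length < Fintype.card σ * (N + 2) ∧ value k x = N := by
  obtain ⟨x, hlen, hx⟩ := exists_lt_length_of_congruence
    (fun x : List (Fin k) => (M.eval x, min (value k x) (N + 1))) (univ ×ˢ range (N + 2))
    (fun x => by simp)
    (fun x y a hxy => by
      simp only [Prod.mk.injEq, DFA.eval_append_singleton, value_concat] at hxy ⊢
      exact ⟨by rw [hxy.1], min_mul_add_congr _ hk hxy.2⟩)
    (fun x => x ∈ M.accepts ∧ value k x = N)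
    (fun x y hxy hx => by
      simp only [Prod.mk.injEq, DFA.mem_accepts] at hxy hx ⊢
      exact ⟨hxy.1 ▸ hx.1, by omega⟩)
    h
  exact ⟨x, hx.1, by simpa using hlen, hx.2⟩

theorem exists_short_num_den_eq {k : ℕ} {σ : Type*} [Fintype σ] (M : DFA (Fin k × Fin k) σ)
    (hk : 2 ≤ k) (p q : ℕ) (h : ∃ w ∈ M.accepts, num k w = p ∧ den k w = q) :
    ∃ w ∈ M.accepts, w.length < Fintype.card σ * ((p + 2) * (q + 2)) ∧
      num k w = p ∧ den k w = q := by
  obtain ⟨x, hlen, hx⟩ := exists_lt_length_of_congruence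
    (fun w : List (Fin k × Fin k) => (M.eval w, min (num k w) (p + 1), min (den k w) (q + 1)))
    (univ ×ˢ range (p + 2) ×ˢ range (q + 2))
    (fun x => by simp)
    (fun x y a hxy => by
      simp only [Prod.mk.injEq, DFA.eval_append_singleton, num_concat, den_concat] at hxy ⊢
      exact ⟨by rw [hxy.1], min_mul_add_congr _ hk hxy.2.1, min_mul_add_congr _ hk hxy.2.2⟩)
    (fun w => w ∈ M.accepts ∧ num k w = p ∧ den k w = q)
    (fun x y hxy hx => by
      simp only [Prod.mk.injEq, DFA.mem_accepts] at hxy hx ⊢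
      exact ⟨hxy.1 ▸ hx.1, by omega, by omega⟩)
    h
  exact ⟨x, hx.1, by simpa using hlen, hx.2⟩

/-- The offset `B` lets the relation `p = c * q` appear as one of the relations `p + B = c * q + i`
that are tracked digit by digit. -/
theorem boundedDvd_iff {k C p q : ℕ} (B : ℕ) :
    BoundedDvd k C p q ↔ q ≠ 0 ∧ ((∃ c < C, p + B = c * q + B) ∨
      ∃ d < C, d ≠ 0 ∧ ∃ j, q = d * k ^ j ∧ q ∣ p) := by
  constructor
  · rintro ⟨hq, hdvd, h | ⟨d, hd, j, rfl⟩⟩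
    · obtain ⟨c, rfl⟩ := hdvd
      refine ⟨hq, Or.inl ⟨c, ?_, by ring⟩⟩
      rw [mul_comm] at h
      exact lt_of_mul_lt_mul_right h (Nat.zero_le _)
    · exact ⟨hq, Or.inr ⟨d, hd, left_ne_zero_of_mul hq, j, rfl, hdvd⟩⟩
  · rintro ⟨hq, ⟨c, hc, h⟩ | ⟨d, hd, -, j, rfl, hdvd⟩⟩
    · obtain rfl : p = c * q := by omega
      exact ⟨hq, Dvd.intro_left _ rfl, Or.inl (Nat.mul_lt_mul_of_pos_right hc (by omega))⟩
    · exact ⟨hq, hdvd, Or.inr ⟨d, hd, j, rfl⟩⟩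

/-- If `p - c * q` lies in `[-2C, 2C]` after a letter is read, it did so before: the letter
multiplies it by `k ≥ 2` and adds `a - c * b`, of absolute value below `C * k`. So the relations in
this window form a finite right congruence; the shift by `2 * C` keeps them in `ℕ`. -/
theorem affine_relation_concat {k C a b p q p' q' : ℕ} (hk : 2 ≤ k) (ha : a < k) (hb : b < k)
    (h : ∀ c < C, ∀ i < 4 * C + 1, p + 2 * C = c * q + i → p' + 2 * C = c * q' + i) :
    ∀ c < C, ∀ i < 4 * C + 1, k * p + a + 2 * C = c * (k * q + b) + i →
      k * p' + a + 2 * C = c * (k * q' + b) + i := by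
  intro c hc i hi heq
  have hkey : (k : ℤ) * (p + 2 * C - c * q) = c * b + i - a - 2 * C + k * (2 * C) := by
    have : (k : ℤ) * p + a + 2 * C = c * (k * q + b) + i := by exact_mod_cast heq
    linear_combination this
  zify at hk ha hb hc hi
  have hcb : 0 ≤ (c : ℤ) * b := by positivity
  have hC : (0 : ℤ) ≤ c := by positivity
  have hlow : (0 : ℤ) ≤ p + 2 * C - c * q := by
    by_contra hneg
    have : (p + 2 * C - c * q : ℤ) ≤ -1 := by omega
    nlinarith
  have hupp : (p + 2 * C - c * q : ℤ) ≤ 4 * C := by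
    by_contra hneg
    have : (4 * C + 1 : ℤ) ≤ p + 2 * C - c * q := by omega
    have h2 : (c : ℤ) * b ≤ (C - 1) * (k - 1) :=
      mul_le_mul (by omega) (by omega) (by positivity) (by omega)
    nlinarith
  obtain ⟨i', hi'⟩ := Int.eq_ofNat_of_zero_le hlow
  have h1 := h c (by exact_mod_cast hc) i' (by zify; omega) (by zify; linarith)
  zify at h1 ⊢
  rw [hi'] at hkey
  linear_combination k * h1 + hkey

/-- An exponent `j > 0` makes `k` divide both components, so the last letter is `[0, 0]` and the
condition is inherited from the prefix. For `j = 0` only the value of the denominator up to `d` and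
the numerator modulo `d` matter. -/
theorem den_form_concat_iff {k d a b p q : ℕ} (ha : a < k) (hb : b < k) :
    (∃ j, k * q + b = d * k ^ j ∧ k * q + b ∣ k * p + a) ↔
      (a = 0 ∧ b = 0 ∧ ∃ j, q = d * k ^ j ∧ q ∣ p) ∨ (k * q + b = d ∧ d ∣ k * p + a) := by
  constructor
  · rintro ⟨j, hj, hdvd⟩
    rcases j with _ | j
    · rw [pow_zero, mul_one] at hj
      exact Or.inr ⟨hj, hj ▸ hdvd⟩
    · left
      have hkd : k ∣ k * q + b := hj ▸ Dvd.intro_left (d * k ^ j) (by ring)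
      have hb0 : b = 0 := Nat.eq_zero_of_dvd_of_lt ((Nat.dvd_add_right (Dvd.intro _ rfl)).1 hkd) hb
      have ha0 : a = 0 := Nat.eq_zero_of_dvd_of_lt
        ((Nat.dvd_add_right (Dvd.intro _ rfl)).1 (hkd.trans hdvd)) ha
      subst hb0 ha0
      refine ⟨rfl, rfl, j, ?_, Nat.dvd_of_mul_dvd_mul_left (by omega) hdvd⟩
      exact Nat.eq_of_mul_eq_mul_left (by omega : 0 < k) (by rw [add_zero] at hj; rw [hj]; ring)
  · rintro (⟨rfl, rfl, j, rfl, hdvd⟩ | ⟨h, hdvd⟩)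
    · exact ⟨j + 1, by ring, by simpa using Nat.mul_dvd_mul_left k hdvd⟩
    · exact ⟨0, by simpa using h, h ▸ hdvd⟩

/-- A length below which a word violating `BoundedDvd` shows up, if there is one. -/
def violationBound (n C : ℕ) : ℕ :=
  n * ((C + 1) * (C.factorial * (2 ^ (C * (4 * C + 1)) * 2 ^ C)))

/-- The congruence records the state, the truncated denominator, the numerator modulo `C!` (a common
multiple of all nonzero `d < C`), the valid affine relations, and the `d` for which the power form
holds with divisibility. The factors of `violationBound` count these in the same order up to
grouping. -/
theorem boundedDvd_of_short {k : ℕ} {σ : Type*} [Fintype σ] (M : DFA (Fin k × Fin k) σ)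
    (hk : 2 ≤ k) (C : ℕ) (hC : 0 < C)
    (h : ∀ w ∈ M.accepts, w.length < violationBound (Fintype.card σ) C →
      BoundedDvd k C (num k w) (den k w)) :
    ∀ w ∈ M.accepts, BoundedDvd k C (num k w) (den k w) := by
  classical
  by_contra! hcon
  obtain ⟨w, hlen, hw, hbad⟩ := exists_lt_length_of_congruence
    (fun w : List (Fin k × Fin k) => (M.eval w, min (den k w) C, num k w % C.factorial,
      (range C ×ˢ range (4 * C + 1)).filter
        (fun x => num k w + 2 * C = x.1 * den k w + x.2),
      (range C).filter (fun d => d ≠ 0 ∧ ∃ j, den k w = d * k ^ j ∧ den k w ∣ num k w)))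
    (univ ×ˢ range (C + 1) ×ˢ range C.factorial ×ˢ (range C ×ˢ range (4 * C + 1)).powerset ×ˢ
      (range C).powerset)
    (fun w => by
      simp only [mem_product, mem_univ, mem_range, mem_powerset, filter_subset, and_true, true_and]
      exact ⟨by omega, Nat.mod_lt _ (Nat.factorial_pos C)⟩)
    (fun w w' x hww => by
      simp only [Prod.mk.injEq, filter_inj', mem_product, mem_range, Prod.forall, and_imp]
        at hww
      obtain ⟨h1, h2, h3, h4, h5⟩ := hww
      simp only [Prod.mk.injEq, DFA.eval_append_singleton, num_concat, den_concat, filter_inj',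
        mem_product, mem_range, Prod.forall, and_imp]
      refine ⟨by rw [h1], min_mul_add_congr _ hk h2, ?_, ?_, ?_⟩
      · exact Nat.ModEq.add_right _ (Nat.ModEq.mul_left k h3)
      · intro c i hc hi
        exact ⟨affine_relation_concat hk x.1.isLt x.2.isLt
            (fun c hc i hi => (h4 c i hc hi).1) c hc i hi,
          affine_relation_concat hk x.1.isLt x.2.isLt
            (fun c hc i hi => (h4 c i hc hi).2) c hc i hi⟩
      · intro d hd
        refine and_congr_right fun hd0 => ?_
        rw [den_form_concat_iff x.1.isLt x.2.isLt, den_form_concat_iff x.1.isLt x.2.isLt]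
        have h5' := h5 hd
        simp only [hd0, ne_eq, not_false_eq_true, true_and] at h5'
        rw [h5']
        have hmod : d ∣ k * num k w + x.1 ↔ d ∣ k * num k w' + x.1 :=
          Nat.ModEq.dvd_iff ((Nat.ModEq.add_right _ (Nat.ModEq.mul_left k h3)).of_dvd
            (Nat.dvd_factorial (Nat.pos_of_ne_zero hd0) hd.le)) dvd_rfl
        have hq : k * den k w + x.2 = d ↔ k * den k w' + x.2 = d := by
          have := min_mul_add_congr (x.2 : ℕ) hk h2
          omega
        rw [hmod, hq])
    (fun w => w ∈ M.accepts ∧ ¬ BoundedDvd k C (num k w) (den k w))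
    (fun w w' hww hw => by
      simp only [Prod.mk.injEq, filter_inj', mem_product, mem_range, Prod.forall, and_imp]
        at hww
      obtain ⟨h1, h2, h3, h4, h5⟩ := hww
      refine ⟨?_, fun hb => hw.2 ?_⟩
      · rw [DFA.mem_accepts, ← h1]; exact hw.1
      · rw [boundedDvd_iff (2 * C)] at hb ⊢
        refine ⟨by omega, ?_⟩
        rcases hb.2 with ⟨c, hc, h⟩ | ⟨d, hd, h⟩
        · exact Or.inl ⟨c, hc, (h4 c (2 * C) hc (by omega)).2 h⟩
        · exact Or.inr ⟨d, hd, (h5 hd).2 h⟩)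
    hcon
  refine hbad (h w hw ?_)
  simpa [violationBound] using hlen


/-! ### A finite congruence on digits for the set of quotients -/

section Congruence

variable {k : ℕ} {σ τ : Type} [Fintype σ] [Fintype τ]

/-- The integers that are quotients of accepted words with denominator in `(0, Q)`. -/
def smallQuo (M : DFA (Fin k × Fin k) σ) (Q : ℕ) : Set ℕ :=
  {N | ∃ q < Q, q ≠ 0 ∧ ∃ w ∈ M.accepts, num k w = N * q ∧ den k w = q}

open Classical in
/-- The states reached by the representations of `N`. -/
noncomputable def reprStates (M : DFA (Fin k) τ) (N : ℕ) : Finset τ :=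
  univ.filter fun s => ∃ x, M.eval x = s ∧ value k x = N

open Classical in
/-- The states reached by words with given denominator and with numerator an affine function
of `N`. -/
noncomputable def affineStates (M : DFA (Fin k × Fin k) σ) (Q N : ℕ) :
    Finset (σ × ℕ × ℕ × ℕ) :=
  (univ ×ˢ range Q ×ˢ range Q ×ˢ range Q).filter fun x =>
    ∃ w, M.eval w = x.1 ∧ den k w = x.2.1 ∧ num k w = N * x.2.2.1 + x.2.2.2

/-- All the information on `N` relevant for membership in `smallQuo` and in a value set. -/
noncomputable def profile (M : DFA (Fin k × Fin k) σ) (M' : DFA (Fin k) τ) (Q N : ℕ) :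
    Finset (σ × ℕ × ℕ × ℕ) × Finset τ × Bool :=
  (affineStates M Q N, reprStates M' N, decide (N = 0))

theorem mem_reprStates {M : DFA (Fin k) τ} {N : ℕ} {s : τ} :
    s ∈ reprStates M N ↔ ∃ x, M.eval x = s ∧ value k x = N := by
  simp [reprStates]

theorem mem_affineStates {M : DFA (Fin k × Fin k) σ} {Q N q' q r : ℕ} {s : σ} :
    (s, q', q, r) ∈ affineStates M Q N ↔ (q' < Q ∧ q < Q ∧ r < Q) ∧
      ∃ w, M.eval w = s ∧ den k w = q' ∧ num k w = N * q + r := by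
  simp [affineStates]

theorem reprStates_concat_subset (M : DFA (Fin k) τ) {N N' : ℕ}
    (h : reprStates M N ⊆ reprStates M N') (h0 : N = 0 → N' = 0) (c : Fin k) :
    reprStates M (k * N + c) ⊆ reprStates M (k * N' + c) := by
  intro s hs
  rw [mem_reprStates] at hs ⊢
  obtain ⟨x, rfl, hx⟩ := hs
  -- The empty word represents `0` without being an extension of a representation of `N`; the flag
  -- `N = 0` in `profile` covers this case.
  rcases List.eq_nil_or_concat x with rfl | ⟨x, a, rfl⟩
  · refine ⟨[], rfl, ?_⟩
    have hk : k ≠ 0 := by rintro rfl; exact c.elim0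
    rw [value_nil] at hx ⊢
    have h1 : k * N = 0 ∧ (c : ℕ) = 0 := by omega
    have h2 : N = 0 := by simpa [hk] using h1.1
    simp [h0 h2, h1.2]
  · rw [List.concat_eq_append] at hx ⊢
    rw [value_concat] at hx
    have hk : 0 < k := c.pos
    have h1 : (a : ℕ) = c := by
      have := congrArg (· % k) hx
      simpa [Nat.mul_add_mod, Nat.mod_eq_of_lt a.isLt, Nat.mod_eq_of_lt c.isLt] using this
    have h2 : value k x = N := Nat.eq_of_mul_eq_mul_left hk (by omega)
    obtain ⟨y, hy, hy'⟩ := mem_reprStates.1 (h (mem_reprStates.2 ⟨x, rfl, h2⟩))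
    refine ⟨y ++ [a], ?_, ?_⟩
    · rw [DFA.eval_append_singleton, DFA.eval_append_singleton, hy]
    · rw [value_concat, hy', h1]

/-- Removing a last letter with first component `a` turns the remainder `r` into `r'` with `k * r' =
c * q + r - a`, and `0 ≤ r' < Q` again. Here `q` is the fixed target multiplier of `N`, whereas `q'`
is the denominator read so far. -/
theorem affineStates_concat_subset (M : DFA (Fin k × Fin k) σ) (Q : ℕ) {N N' : ℕ}
    (h : affineStates M Q N ⊆ affineStates M Q N') (h0 : N = 0 → N' = 0) (c : Fin k) :
    affineStates M Q (k * N + c) ⊆ affineStates M Q (k * N' + c) := by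
  rintro ⟨s, q', q, r⟩ hs
  rw [mem_affineStates] at hs ⊢
  obtain ⟨⟨hq', hq, hr⟩, w, rfl, hden, hnum⟩ := hs
  refine ⟨⟨hq', hq, hr⟩, ?_⟩
  have hk : 0 < k := c.pos
  rcases List.eq_nil_or_concat w with rfl | ⟨w, a, rfl⟩
  · refine ⟨[], rfl, hden, ?_⟩
    rw [num_nil] at hnum ⊢
    have h1 : (k * N + c) * q = 0 ∧ r = 0 := by omega
    rcases Nat.mul_eq_zero.1 h1.1 with h2 | h2
    · have h3 : k * N = 0 ∧ (c : ℕ) = 0 := by omega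
      have h4 : N = 0 := by simpa [hk.ne'] using h3.1
      rw [h0 h4, h3.2, h1.2]; simp
    · rw [h2, h1.2]; simp
  · rw [List.concat_eq_append] at hden hnum ⊢
    rw [den_concat] at hden
    rw [num_concat] at hnum
    have hkey : (k : ℤ) * (num k w - N * q) = c * q + r - (a.1 : ℕ) := by
      have : (k : ℤ) * num k w + (a.1 : ℕ) = (k * N + (c : ℕ)) * q + r := by exact_mod_cast hnum
      linear_combination this
    have ha := a.1.isLt
    have hc := c.isLt
    have hcq : (0 : ℤ) ≤ (c : ℕ) * q := by positivity
    zify at ha hc hk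
    have hlow : (0 : ℤ) ≤ num k w - N * q := by
      by_contra hneg
      have : (num k w - N * q : ℤ) ≤ -1 := by omega
      nlinarith
    have hupp : (num k w - N * q : ℤ) < Q := by
      by_contra hneg
      have h1 : (Q : ℤ) ≤ num k w - N * q := by omega
      have h2 : ((c : ℕ) : ℤ) * q ≤ (k - 1) * (Q - 1) :=
        mul_le_mul (by omega) (by omega) (by positivity) (by omega)
      nlinarith
    obtain ⟨r', hr'⟩ := Int.eq_ofNat_of_zero_le hlow
    have hdw : den k w < Q := by
      have : den k w ≤ k * den k w := Nat.le_mul_of_pos_left _ (by omega)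
      omega
    have hmem : (M.eval w, den k w, q, r') ∈ affineStates M Q N :=
      mem_affineStates.2 ⟨⟨hdw, hq, by omega⟩, w, rfl, rfl, by zify; linarith⟩
    obtain ⟨-, w', h1, h2, h3⟩ := mem_affineStates.1 (h hmem)
    refine ⟨w' ++ [a], ?_, ?_, ?_⟩
    · rw [DFA.eval_append_singleton, DFA.eval_append_singleton, h1]
    · rw [den_concat, h2, hden]
    · rw [num_concat, h3]
      rw [hr'] at hkey
      zify
      linear_combination hkey

theorem profile_concat (M : DFA (Fin k × Fin k) σ) (M' : DFA (Fin k) τ) (Q : ℕ) {N N' : ℕ}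
    (h : profile M M' Q N = profile M M' Q N') (c : Fin k) :
    profile M M' Q (k * N + c) = profile M M' Q (k * N' + c) := by
  simp only [profile, Prod.mk.injEq, decide_eq_decide] at h ⊢
  obtain ⟨h1, h2, h3⟩ := h
  have hk : k ≠ 0 := c.pos.ne'
  refine ⟨?_, ?_, ?_⟩
  · exact (affineStates_concat_subset M Q h1.subset h3.1 c).antisymm
      (affineStates_concat_subset M Q h1.symm.subset h3.2 c)
  · exact (reprStates_concat_subset M' h2.subset h3.1 c).antisymm
      (reprStates_concat_subset M' h2.symm.subset h3.2 c)
  · simp [hk, h3]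

theorem mem_valueSet_iff (M : DFA (Fin k) τ) (N : ℕ) :
    N ∈ valueSet k M.accepts ↔ ∃ s ∈ M.accept, s ∈ reprStates M N := by
  simp only [valueSet, Set.mem_ofPred_eq, mem_reprStates, DFA.mem_accepts]
  constructor
  · rintro ⟨x, hx, h⟩
    exact ⟨_, hx, x, rfl, h⟩
  · rintro ⟨s, hs, x, rfl, h⟩
    exact ⟨x, hs, h⟩

theorem mem_smallQuo_iff (M : DFA (Fin k × Fin k) σ) (Q N : ℕ) :
    N ∈ smallQuo M Q ↔ ∃ q < Q, q ≠ 0 ∧ ∃ s ∈ M.accept, (s, q, q, 0) ∈ affineStates M Q N := by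
  simp only [smallQuo, Set.mem_ofPred_eq, mem_affineStates, DFA.mem_accepts]
  constructor
  · rintro ⟨q, hq, hq0, w, hw, h1, h2⟩
    exact ⟨q, hq, hq0, _, hw, ⟨hq, hq, by omega⟩, w, rfl, h2, h1⟩
  · rintro ⟨q, hq, hq0, s, hs, -, w, rfl, h2, h1⟩
    exact ⟨q, hq, hq0, w, hs, h1, h2⟩

/-- A bound on the number of digits of the least number that distinguishes `smallQuo` from a
value set. -/
def profileBound (n m Q : ℕ) : ℕ := 2 ^ (n * (Q * (Q * Q))) * (2 ^ m * 2)

/-- The finite set of all possible profiles. -/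
def profiles (σ τ : Type) [Fintype σ] [Fintype τ] (Q : ℕ) :
    Finset (Finset (σ × ℕ × ℕ × ℕ) × Finset τ × Bool) :=
  (univ ×ˢ range Q ×ˢ range Q ×ˢ range Q).powerset ×ˢ univ.powerset ×ˢ univ

theorem card_profiles (Q : ℕ) :
    (profiles σ τ Q).card = profileBound (Fintype.card σ) (Fintype.card τ) Q := by
  simp [profiles, profileBound]

theorem profile_mem_profiles (M : DFA (Fin k × Fin k) σ) (M' : DFA (Fin k) τ) (Q N : ℕ) :
    profile M M' Q N ∈ profiles σ τ Q := by
  simp [profiles, profile, affineStates, em]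

/-- The profile determines both memberships, so a witness has a short representation. The relation
`R` is left arbitrary so that failures of either inclusion are covered at once. -/
theorem exists_lt_of_mem_smallQuo_valueSet (hk : 2 ≤ k) (M : DFA (Fin k × Fin k) σ)
    (M' : DFA (Fin k) τ) (Q : ℕ) (R : Prop → Prop → Prop)
    (h : ∃ N, R (N ∈ smallQuo M Q) (N ∈ valueSet k M'.accepts)) :
    ∃ N < k ^ profileBound (Fintype.card σ) (Fintype.card τ) Q,
      R (N ∈ smallQuo M Q) (N ∈ valueSet k M'.accepts) := by
  obtain ⟨x, hlen, hx⟩ := exists_lt_length_of_congruence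
    (fun x : List (Fin k) => profile M M' Q (value k x)) (profiles σ τ Q)
    (fun x => profile_mem_profiles M M' Q _)
    (fun x y a hxy => by
      simp only [value_concat]
      exact profile_concat M M' Q hxy a)
    (fun x => R (value k x ∈ smallQuo M Q) (value k x ∈ valueSet k M'.accepts))
    (fun x y hxy hx => by
      simp only [profile, Prod.mk.injEq] at hxy
      rw [mem_smallQuo_iff, mem_valueSet_iff] at hx ⊢
      rwa [← hxy.1, ← hxy.2.1])
    (by
      obtain ⟨N, hN⟩ := h
      obtain ⟨x, -, rfl⟩ := exists_value_eq hk N N (Nat.lt_pow_self (by omega))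
      exact ⟨x, hN⟩)
  refine ⟨value k x, (value_lt hk x).trans_le (Nat.pow_le_pow_right (by omega) ?_), hx⟩
  rw [← card_profiles]
  exact hlen.le

/-- Equal profiles give equal left quotients of the language of all representations of members, so
Myhill–Nerode applies. -/
theorem exists_lang_valueSet_eq_smallQuo (hk : 2 ≤ k) (M : DFA (Fin k × Fin k) σ) (Q : ℕ) :
    ∃ c : DFACode, valueSet k (c.lang k) = smallQuo M Q := by
  -- A dummy automaton: the value-set component of the profile plays no role here.
  let M' : DFA (Fin k) Unit := ⟨fun _ _ => (), (), ∅⟩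
  let L : Language (Fin k) := {x | value k x ∈ smallQuo M Q}
  have happ : ∀ y x x' : List (Fin k), profile M M' Q (value k x) = profile M M' Q (value k x') →
      profile M M' Q (value k (x ++ y)) = profile M M' Q (value k (x' ++ y)) := by
    intro y
    induction y with
    | nil => intro x x' h; simpa using h
    | cons a y ih =>
      intro x x' h
      have := ih (x ++ [a]) (x' ++ [a]) (by
        rw [value_concat, value_concat]; exact profile_concat M M' Q h a)
      simpa using this
  have hfin : (Set.range L.leftQuotient).Finite := by
    have hfac : ∀ x x', profile M M' Q (value k x) = profile M M' Q (value k x') →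
        L.leftQuotient x = L.leftQuotient x' := by
      intro x x' h
      ext y
      have h1 := happ y x x' h
      simp only [profile, Prod.mk.injEq] at h1
      change value k (x ++ y) ∈ smallQuo M Q ↔ value k (x' ++ y) ∈ smallQuo M Q
      rw [mem_smallQuo_iff, mem_smallQuo_iff, h1.1]
    have hfin' : (Set.range fun x => profile M M' Q (value k x)).Finite :=
      (profiles σ Unit Q).finite_toSet.subset (by
        rintro _ ⟨x, rfl⟩; exact profile_mem_profiles M M' Q _)
    obtain ⟨g, hg⟩ : ∃ g, L.leftQuotient = g ∘ fun x => profile M M' Q (value k x) :=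
      (Function.factorsThrough_iff _).1 (fun x x' h => hfac x x' h)
    rw [hg, Set.range_comp]
    exact hfin'.image g
  obtain ⟨ρ, _, A, hA⟩ := Language.IsRegular.of_finite_range_leftQuotient hfin
  obtain ⟨c, hc⟩ := DFACode.exists_accepts_eq (fun a : Fin k => (a : ℕ)) Fin.val_injective A
  refine ⟨c, ?_⟩
  rw [DFACode.lang, hc, hA]
  ext N
  constructor
  · rintro ⟨x, hx, rfl⟩
    exact hx
  · intro hN
    obtain ⟨x, -, rfl⟩ := exists_value_eq hk N N (Nat.lt_pow_self (by omega))
    exact ⟨x, hN, rfl⟩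

end Congruence

/-! ### Bounded numerical tests on descriptions and their correctness -/

theorem div_pow_mod_value {k : ℕ} (hk : 2 ≤ k) (x : List (Fin k)) (i : ℕ) (hi : i < x.length) :
    value k x / k ^ (x.length - 1 - i) % k = x[i] := by
  have hx : x = (x.take i ++ [x[i]]) ++ x.drop (i + 1) := by simp
  have hlen : (x.drop (i + 1)).length = x.length - 1 - i := by simp; omega
  have hlt := value_lt hk (x.drop (i + 1))
  have hval : value k x = (k * value k (x.take i) + x[i]) * k ^ (x.length - 1 - i) +
      value k (x.drop (i + 1)) := by
    conv_lhs => rw [hx]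
    rw [value_append, value_concat, hlen]
  rw [hlen] at hlt
  rw [hval, mul_comm, Nat.mul_add_div (Nat.pow_pos (by omega)), Nat.div_eq_of_lt hlt, add_zero,
    Nat.mul_add_mod, Nat.mod_eq_of_lt x[i].isLt]

namespace DFACode

/-- The state reached after reading `l` letters, the letter number `i` having index `g i`. -/
def runIndex (c : DFACode) (g : ℕ → ℕ) (l : ℕ) : ℕ :=
  Nat.rec (c.start % (c.size + 1))
    (fun i s => ((c.table.getD s []).getD (g i) 0) % (c.size + 1)) l

theorem runIndex_eq_eval {α : Type} (c : DFACode) (index : α → ℕ) (g : ℕ → ℕ) (w : List α)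
    (hg : ∀ i (h : i < w.length), g i = index w[i]) :
    c.runIndex g w.length = ((c.toDFA index).eval w : ℕ) := by
  induction w using List.reverseRecOn with
  | nil => rfl
  | append_singleton w a ih =>
    have h1 := ih (fun i hi => by
      rw [hg i (by simp; omega), List.getElem_append_left hi])
    have h2 := hg w.length (by simp)
    rw [List.getElem_concat_length rfl] at h2
    rw [DFA.eval_append_singleton, List.length_append, List.length_singleton]
    change (c.table.getD (c.runIndex g w.length) []).getD (g w.length) 0 % (c.size + 1) = _
    rw [h1, h2]
    rfl

/-- Acceptance of the word of length `l` over `Σ_k²` with numerator `p` and denominator `q`. -/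
def AcceptsNat (k : ℕ) (c : DFACode) (l p q : ℕ) : Prop :=
  c.runIndex (fun i => p / k ^ (l - 1 - i) % k * k + q / k ^ (l - 1 - i) % k) l ∈ c.accept

theorem acceptsNat_iff_mem_langPair {k : ℕ} (hk : 2 ≤ k) (c : DFACode)
    (w : List (Fin k × Fin k)) :
    c.AcceptsNat k w.length (num k w) (den k w) ↔ w ∈ c.langPair k := by
  rw [AcceptsNat, runIndex_eq_eval c (fun a : Fin k × Fin k => (a.1 : ℕ) * k + a.2)]
  · rfl
  · intro i hi
    have h1 := div_pow_mod_value hk (w.map Prod.fst) i (by simpa using hi)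
    have h2 := div_pow_mod_value hk (w.map Prod.snd) i (by simpa using hi)
    simp only [List.length_map, List.getElem_map] at h1 h2
    rw [num, den, h1, h2]

/-- With numerator `0` the pair index `a * k + b` reduces to `b`, so one acceptance predicate serves
both alphabets. -/
theorem acceptsNat_iff_mem_lang {k : ℕ} (hk : 2 ≤ k) (c : DFACode) (x : List (Fin k)) :
    c.AcceptsNat k x.length 0 (value k x) ↔ x ∈ c.lang k := by
  rw [AcceptsNat, runIndex_eq_eval c (fun a : Fin k => (a : ℕ))]
  · rfl
  · intro i hi
    rw [div_pow_mod_value hk x i hi]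
    simp

/-- A decidable criterion for all quotients to be defined and integral. -/
def IntegralTest (k : ℕ) (c : DFACode) : Prop :=
  ∀ l < violationBound (c.size + 1) (k ^ (c.size + 2)), ∀ p < k ^ l, ∀ q < k ^ l,
    ¬ c.AcceptsNat k l p q ∨ (q ≠ 0 ∧ p % q = 0 ∧ (p < k ^ (c.size + 2) * q ∨
      ∃ d < k ^ (c.size + 2), ∃ j < q, q = d * k ^ j))

/-- A decidable criterion for membership in the value set. -/
def ValueTest (k : ℕ) (c : DFACode) (N : ℕ) : Prop :=
  ∃ l < (c.size + 1) * (N + 2), N < k ^ l ∧ c.AcceptsNat k l 0 N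

/-- A decidable criterion for membership in the set of quotients. -/
def QuotientTest (k : ℕ) (c : DFACode) (N : ℕ) : Prop :=
  ∃ q < k ^ (c.size + 2), q ≠ 0 ∧ ∃ l < (c.size + 1) * ((N * q + 2) * (q + 2)),
    N * q < k ^ l ∧ q < k ^ l ∧ c.AcceptsNat k l (N * q) q

/-- The exponent can be bounded by `q`, since `j < k^j ≤ d * k^j = q`; this makes the quantifier
primitive recursive. -/
theorem boundedDvd_iff_bounded {k C p q : ℕ} (hk : 2 ≤ k) : BoundedDvd k C p q ↔
    (q ≠ 0 ∧ p % q = 0 ∧ (p < C * q ∨ ∃ d < C, ∃ j < q, q = d * k ^ j)) := by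
  rw [BoundedDvd, Nat.dvd_iff_mod_eq_zero]
  refine and_congr_right fun hq => and_congr_right fun _ => or_congr_right ?_
  constructor
  · rintro ⟨d, hd, j, hj⟩
    refine ⟨d, hd, j, ?_, hj⟩
    have hd0 : d ≠ 0 := by rintro rfl; simp at hj; exact hq hj
    calc j < k ^ j := Nat.lt_pow_self (by omega)
      _ ≤ d * k ^ j := Nat.le_mul_of_pos_left _ (Nat.pos_of_ne_zero hd0)
      _ = q := hj.symm
  · rintro ⟨d, hd, j, -, hj⟩
    exact ⟨d, hd, j, hj⟩

/-- Passing the test on short words gives `BoundedDvd` everywhere, hence divisibility; conversely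
integrality gives `BoundedDvd`. The constant `k^(size + 2)` is `k^(n+1)` for `n = size + 1` states.
-/
theorem integralTest_iff {k : ℕ} (hk : 2 ≤ k) (c : DFACode) :
    c.IntegralTest k ↔ ∀ w ∈ c.langPair k, den k w ≠ 0 ∧ den k w ∣ num k w := by
  constructor
  · intro h w hw
    have := boundedDvd_of_short (c.toDFA (fun a : Fin k × Fin k => (a.1 : ℕ) * k + a.2)) hk
      (k ^ (c.size + 2)) (Nat.pow_pos (by omega)) ?_ w hw
    · exact ⟨this.1, this.2.1⟩
    · intro w hw hlen
      rw [Fintype.card_fin] at hlen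
      rw [boundedDvd_iff_bounded hk]
      exact (h w.length hlen _ (num_lt hk w) _ (den_lt hk w)).resolve_left
        (not_not.2 ((acceptsNat_iff_mem_langPair hk c w).2 hw))
  · intro h l _ p hp q hq
    obtain ⟨w, rfl, rfl, rfl⟩ := exists_num_den_eq hk l p q hp hq
    rw [acceptsNat_iff_mem_langPair hk, ← imp_iff_not_or, ← boundedDvd_iff_bounded hk]
    intro hw
    have := boundedDvd_of_dvd (c.toDFA (fun a : Fin k × Fin k => (a.1 : ℕ) * k + a.2)) hk h w hw
    rwa [Fintype.card_fin] at this

theorem valueTest_iff {k : ℕ} (hk : 2 ≤ k) (c : DFACode) (N : ℕ) :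
    c.ValueTest k N ↔ N ∈ valueSet k (c.lang k) := by
  constructor
  · rintro ⟨l, -, hN, h⟩
    obtain ⟨x, rfl, rfl⟩ := exists_value_eq hk l N hN
    exact ⟨x, (acceptsNat_iff_mem_lang hk c x).1 h, rfl⟩
  · intro h
    obtain ⟨x, hx, hlen, rfl⟩ := exists_short_value_eq _ hk N h
    rw [Fintype.card_fin] at hlen
    exact ⟨x.length, hlen, value_lt hk x, (acceptsNat_iff_mem_lang hk c x).2 hx⟩

theorem quotientTest_iff {k : ℕ} (hk : 2 ≤ k) (c : DFACode) (N : ℕ) :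
    c.QuotientTest k N ↔ N ∈ smallQuo
      (c.toDFA (fun a : Fin k × Fin k => (a.1 : ℕ) * k + a.2)) (k ^ (c.size + 2)) := by
  refine exists_congr fun q => and_congr_right fun _ => and_congr_right fun _ => ?_
  constructor
  · rintro ⟨l, -, hp, hq, h⟩
    obtain ⟨w, rfl, h1, h2⟩ := exists_num_den_eq hk l _ q hp hq
    refine ⟨w, (acceptsNat_iff_mem_langPair hk c w).1 ?_, h1, h2⟩
    rwa [h1, h2]
  · intro h
    obtain ⟨w, hw, hlen, h1, h2⟩ := exists_short_num_den_eq _ hk _ q h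
    rw [Fintype.card_fin] at hlen
    refine ⟨w.length, hlen, h1 ▸ num_lt hk w, ?_, ?_⟩
    · have := den_lt hk w
      rwa [h2] at this
    · have := (acceptsNat_iff_mem_langPair hk c w).2 hw
      rwa [h1, h2] at this

theorem integral_iff {k : ℕ} (L : Language (Fin k × Fin k)) :
    (∀ w ∈ L, den k w ≠ 0 ∧ den k w ∣ num k w) ↔
      QuoDefined k L ∧ quoSet k L ⊆ natsInRat Set.univ := by
  constructor
  · intro h
    refine ⟨fun w hw => (h w hw).1, ?_⟩
    rintro _ ⟨w, hw, rfl⟩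
    exact ⟨num k w / den k w, trivial, Nat.cast_div (h w hw).2 (by exact_mod_cast (h w hw).1)⟩
  · rintro ⟨hdef, hsub⟩ w hw
    refine ⟨hdef w hw, ?_⟩
    obtain ⟨N, -, hN⟩ := hsub ⟨w, hw, rfl⟩
    have h0 : (den k w : ℚ) ≠ 0 := by exact_mod_cast hdef w hw
    simp only [quo] at hN
    rw [eq_div_iff h0] at hN
    exact Dvd.intro_left N (by exact_mod_cast hN)

/-- `exists_den_lt_of_dvd` replaces each accepted word by one with the same quotient and small
denominator. -/
theorem quoSet_eq_smallQuo {k : ℕ} (hk : 2 ≤ k) (c : DFACode)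
    (h : ∀ w ∈ c.langPair k, den k w ≠ 0 ∧ den k w ∣ num k w) :
    quoSet k (c.langPair k) = natsInRat (smallQuo
      (c.toDFA (fun a : Fin k × Fin k => (a.1 : ℕ) * k + a.2)) (k ^ (c.size + 2))) := by
  ext x
  constructor
  · rintro ⟨w, hw, rfl⟩
    obtain ⟨w', hw', hlt, heq⟩ := exists_den_lt_of_dvd _ hk h w hw
    rw [Fintype.card_fin] at hlt
    obtain ⟨h0, N, hN⟩ := h w' hw'
    refine ⟨N, ⟨den k w', hlt.trans_le (Nat.pow_le_pow_right (by omega) (by omega)), h0, w', hw',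
      by rw [hN, mul_comm], rfl⟩, ?_⟩
    have h1 : (den k w : ℚ) ≠ 0 := by exact_mod_cast (h w hw).1
    rw [quo, eq_div_iff h1]
    have : N * den k w = num k w := by
      refine Nat.eq_of_mul_eq_mul_left (Nat.pos_of_ne_zero h0) ?_
      rw [hN] at heq
      linarith
    change (N : ℚ) * den k w = num k w
    exact_mod_cast this
  · rintro ⟨N, ⟨q, -, hq0, w, hw, h1, h2⟩, rfl⟩
    refine ⟨w, hw, ?_⟩
    have : (q : ℚ) ≠ 0 := by exact_mod_cast hq0
    rw [quo, h1, h2]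
    push_cast
    field_simp

/-- A decidable criterion for the quotients to form a subset of a value set. -/
def SubsetTest (k : ℕ) (c₁ c₂ : DFACode) : Prop :=
  c₁.IntegralTest k ∧ ∀ N < k ^ profileBound (c₁.size + 1) (c₂.size + 1) (k ^ (c₁.size + 2)),
    ¬ c₁.QuotientTest k N ∨ c₂.ValueTest k N

/-- A decidable criterion for a value set to consist of quotients. -/
def SupsetTest (k : ℕ) (c₁ c₂ : DFACode) : Prop :=
  ∀ N < k ^ profileBound (c₁.size + 1) (c₂.size + 1) (k ^ (c₁.size + 2)),
    c₁.QuotientTest k N ∨ ¬ c₂.ValueTest k N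

theorem natsInRat_subset_iff {A B : Set ℕ} : natsInRat A ⊆ natsInRat B ↔ A ⊆ B :=
  Set.image_subset_image_iff Nat.cast_injective

theorem subsetTest_iff {k : ℕ} (hk : 2 ≤ k) (c₁ c₂ : DFACode) :
    c₁.SubsetTest k c₂ ↔ QuoDefined k (c₁.langPair k) ∧
      quoSet k (c₁.langPair k) ⊆ natsInRat (valueSet k (c₂.lang k)) := by
  have hint := (integralTest_iff hk c₁).trans (integral_iff _)
  -- Inclusion in a set of natural numbers already contains integrality, so the integrality test may
  -- be added and then assumed.
  have hrw : QuoDefined k (c₁.langPair k) ∧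
      quoSet k (c₁.langPair k) ⊆ natsInRat (valueSet k (c₂.lang k)) ↔ c₁.IntegralTest k ∧
      quoSet k (c₁.langPair k) ⊆ natsInRat (valueSet k (c₂.lang k)) := by
    rw [hint]
    exact ⟨fun h => ⟨⟨h.1, h.2.trans (Set.image_mono (Set.subset_univ _))⟩, h.2⟩,
      fun h => ⟨h.1.1, h.2⟩⟩
  rw [hrw]
  refine and_congr_right fun h => ?_
  rw [quoSet_eq_smallQuo hk c₁ ((integralTest_iff hk c₁).1 h), natsInRat_subset_iff]
  simp only [quotientTest_iff hk, valueTest_iff hk, ← imp_iff_not_or]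
  constructor
  · intro H
    by_contra hcon
    obtain ⟨N, hN, hbad⟩ := exists_lt_of_mem_smallQuo_valueSet hk
      (c₁.toDFA (fun a : Fin k × Fin k => (a.1 : ℕ) * k + a.2))
      (c₂.toDFA (fun a : Fin k => (a : ℕ))) (k ^ (c₁.size + 2)) (fun P R => ¬ (P → R))
      (by simpa [Set.subset_def, lang] using hcon)
    rw [Fintype.card_fin, Fintype.card_fin] at hN
    exact hbad (H N hN)
  · intro H N _ hN
    exact H hN

theorem subsetTest_and_supsetTest_iff {k : ℕ} (hk : 2 ≤ k) (c₁ c₂ : DFACode) :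
    c₁.SubsetTest k c₂ ∧ c₁.SupsetTest k c₂ ↔ QuoDefined k (c₁.langPair k) ∧
      quoSet k (c₁.langPair k) = natsInRat (valueSet k (c₂.lang k)) := by
  have hsup : c₁.IntegralTest k → (c₁.SupsetTest k c₂ ↔
      natsInRat (valueSet k (c₂.lang k)) ⊆ quoSet k (c₁.langPair k)) := by
    intro h
    rw [quoSet_eq_smallQuo hk c₁ ((integralTest_iff hk c₁).1 h), natsInRat_subset_iff]
    simp only [SupsetTest, quotientTest_iff hk, valueTest_iff hk, ← imp_iff_or_not]
    constructor
    · intro H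
      by_contra hcon
      obtain ⟨N, hN, hbad⟩ := exists_lt_of_mem_smallQuo_valueSet hk
        (c₁.toDFA (fun a : Fin k × Fin k => (a.1 : ℕ) * k + a.2))
        (c₂.toDFA (fun a : Fin k => (a : ℕ))) (k ^ (c₁.size + 2)) (fun P R => ¬ (R → P))
        (by simpa [Set.subset_def, lang] using hcon)
      rw [Fintype.card_fin, Fintype.card_fin] at hN
      exact hbad (H N hN)
    · intro H N _ hN
      exact H hN
  rw [Set.Subset.antisymm_iff, ← and_assoc, ← subsetTest_iff hk]
  exact and_congr_right fun h => hsup h.1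

/-- A description of the automaton that accepts every word. -/
def full : DFACode := ⟨0, 0, [], [0]⟩

theorem valueSet_full {k : ℕ} (hk : 2 ≤ k) : valueSet k (full.lang k) = Set.univ := by
  rw [Set.eq_univ_iff_forall]
  intro N
  obtain ⟨x, -, rfl⟩ := exists_value_eq hk N N (Nat.lt_pow_self (by omega))
  refine ⟨x, ?_, rfl⟩
  rw [lang, DFA.mem_accepts]
  have : ∀ s : Fin 1, (s : ℕ) ∈ [0] := by decide
  exact this _

end DFACode

end AutomaticRationals

/-! ### Primitive recursiveness of the tests -/

theorem Primrec.natPow {α : Type*} [Primcodable α] {f g : α → ℕ} (hf : Primrec f)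
    (hg : Primrec g) : Primrec fun a => f a ^ g a :=
  (Primrec₂.unpaired'.1 Nat.Primrec.pow).comp hf hg

theorem Primrec.natFactorial : Primrec Nat.factorial :=
  (Primrec.nat_rec₁ (f := fun n m => (n + 1) * m) 1
    (Primrec.nat_mul.comp (Primrec.succ.comp Primrec.fst) Primrec.snd)).of_eq fun n => by
      induction n with
      | zero => rfl
      | succ n ih => simp only [Nat.factorial_succ, ← ih]

theorem PrimrecPred.forall_lt_of {α : Type*} [Primcodable α] {f : α → ℕ} {p : α × ℕ → Prop}
    (hf : Primrec f) (hp : PrimrecPred p) : PrimrecPred fun a => ∀ x < f a, p (a, x) :=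
  ((PrimrecRel.forall_mem_list (R := fun (x : ℕ) (a : α) => p (a, x))
    (hp.comp (Primrec.snd.pair Primrec.fst))).comp
      (Primrec.list_range.comp hf) Primrec.id).of_eq (by simp)

theorem PrimrecPred.exists_lt_of {α : Type*} [Primcodable α] {f : α → ℕ} {p : α × ℕ → Prop}
    (hf : Primrec f) (hp : PrimrecPred p) : PrimrecPred fun a => ∃ x < f a, p (a, x) :=
  ((PrimrecRel.exists_mem_list (R := fun (x : ℕ) (a : α) => p (a, x))
    (hp.comp (Primrec.snd.pair Primrec.fst))).comp
      (Primrec.list_range.comp hf) Primrec.id).of_eq (by simp)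

namespace AutomaticRationals

namespace DFACode

section Primrec

variable {α : Type} [Primcodable α]

theorem primrec_size : Primrec DFACode.size :=
  Primrec.fst.comp (Primrec.of_equiv (e := equivProd))

theorem primrec_start : Primrec DFACode.start :=
  (Primrec.fst.comp Primrec.snd).comp (Primrec.of_equiv (e := equivProd))

theorem primrec_table : Primrec DFACode.table :=
  (Primrec.fst.comp (Primrec.snd.comp Primrec.snd)).comp (Primrec.of_equiv (e := equivProd))

theorem primrec_accept : Primrec DFACode.accept :=
  (Primrec.snd.comp (Primrec.snd.comp Primrec.snd)).comp (Primrec.of_equiv (e := equivProd))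

theorem primrec_runIndex {c : α → DFACode} {g : α × ℕ → ℕ} {l : α → ℕ} (hc : Primrec c)
    (hg : Primrec g) (hl : Primrec l) :
    Primrec fun a => (c a).runIndex (fun i => g (a, i)) (l a) := by
  have hsize : Primrec fun a => (c a).size + 1 := Primrec.succ.comp (primrec_size.comp hc)
  refine Primrec.nat_rec' hl (Primrec.nat_mod.comp (primrec_start.comp hc) hsize)
    (h := fun a x => (((c a).table.getD x.2 []).getD (g (a, x.1)) 0) % ((c a).size + 1)) ?_
  refine Primrec.nat_mod.comp ((Primrec.list_getD 0).comp ((Primrec.list_getD []).comp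
    (primrec_table.comp (hc.comp Primrec.fst)) (Primrec.snd.comp Primrec.snd))
    (hg.comp (Primrec.fst.pair (Primrec.fst.comp Primrec.snd)))) (hsize.comp Primrec.fst)

theorem primrecPred_acceptsNat {k l p q : α → ℕ} {c : α → DFACode} (hk : Primrec k)
    (hc : Primrec c) (hl : Primrec l) (hp : Primrec p) (hq : Primrec q) :
    PrimrecPred fun a => (c a).AcceptsNat (k a) (l a) (p a) (q a) := by
  have hmem : PrimrecRel fun (L : List ℕ) (b : ℕ) => b ∈ L :=
    (PrimrecRel.exists_mem_list (R := fun a b : ℕ => a = b) Primrec.eq).of_eq (by simp)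
  have hpow : Primrec fun x : α × ℕ => k x.1 ^ (l x.1 - 1 - x.2) :=
    Primrec.natPow (hk.comp Primrec.fst) (Primrec.nat_sub.comp
      (Primrec.nat_sub.comp (hl.comp Primrec.fst) (Primrec.const 1)) Primrec.snd)
  refine hmem.comp (primrec_accept.comp hc) (primrec_runIndex (g := fun x : α × ℕ =>
    p x.1 / k x.1 ^ (l x.1 - 1 - x.2) % k x.1 * k x.1 +
      q x.1 / k x.1 ^ (l x.1 - 1 - x.2) % k x.1) hc ?_ hl)
  have hdig : ∀ {r : α → ℕ}, Primrec r →
      Primrec fun x : α × ℕ => r x.1 / k x.1 ^ (l x.1 - 1 - x.2) % k x.1 := fun hr =>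
    Primrec.nat_mod.comp (Primrec.nat_div.comp (hr.comp Primrec.fst) hpow) (hk.comp Primrec.fst)
  exact Primrec.nat_add.comp (Primrec.nat_mul.comp (hdig hp) (hk.comp Primrec.fst)) (hdig hq)

theorem primrec_violationBound {n C : α → ℕ} (hn : Primrec n) (hC : Primrec C) :
    Primrec fun a => violationBound (n a) (C a) := by
  have h2 : Primrec fun _ : α => 2 := Primrec.const 2
  have h4 : Primrec fun a => 4 * C a + 1 :=
    Primrec.succ.comp (Primrec.nat_mul.comp (Primrec.const 4) hC)
  exact Primrec.nat_mul.comp hn (Primrec.nat_mul.comp (Primrec.succ.comp hC)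
    (Primrec.nat_mul.comp (Primrec.natFactorial.comp hC) (Primrec.nat_mul.comp
      (Primrec.natPow h2 (Primrec.nat_mul.comp hC h4)) (Primrec.natPow h2 hC))))

theorem primrec_profileBound {n m Q : α → ℕ} (hn : Primrec n) (hm : Primrec m)
    (hQ : Primrec Q) : Primrec fun a => profileBound (n a) (m a) (Q a) := by
  have h2 : Primrec fun _ : α => 2 := Primrec.const 2
  exact Primrec.nat_mul.comp (Primrec.natPow h2 (Primrec.nat_mul.comp hn
    (Primrec.nat_mul.comp hQ (Primrec.nat_mul.comp hQ hQ))))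
    (Primrec.nat_mul.comp (Primrec.natPow h2 hm) h2)

theorem primrec_pow_size {k : α → ℕ} {c : α → DFACode} (hk : Primrec k) (hc : Primrec c) :
    Primrec fun a => k a ^ ((c a).size + 2) :=
  Primrec.natPow hk (Primrec.nat_add.comp (primrec_size.comp hc) (Primrec.const 2))

theorem primrecPred_integralTest {k : α → ℕ} {c : α → DFACode} (hk : Primrec k)
    (hc : Primrec c) : PrimrecPred fun a => (c a).IntegralTest (k a) := by
  have hC := primrec_pow_size hk hc
  unfold IntegralTest
  refine PrimrecPred.forall_lt_of (p := fun x : α × ℕ => ∀ p < k x.1 ^ x.2, ∀ q < k x.1 ^ x.2,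
    ¬ (c x.1).AcceptsNat (k x.1) x.2 p q ∨ (q ≠ 0 ∧ p % q = 0 ∧
      (p < k x.1 ^ ((c x.1).size + 2) * q ∨
        ∃ d < k x.1 ^ ((c x.1).size + 2), ∃ j < q, q = d * k x.1 ^ j)))
    (primrec_violationBound (Primrec.succ.comp (primrec_size.comp hc)) hC) ?_
  refine PrimrecPred.forall_lt_of (p := fun x : (α × ℕ) × ℕ => ∀ q < k x.1.1 ^ x.1.2,
    ¬ (c x.1.1).AcceptsNat (k x.1.1) x.1.2 x.2 q ∨ (q ≠ 0 ∧ x.2 % q = 0 ∧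
      (x.2 < k x.1.1 ^ ((c x.1.1).size + 2) * q ∨
        ∃ d < k x.1.1 ^ ((c x.1.1).size + 2), ∃ j < q, q = d * k x.1.1 ^ j)))
    (Primrec.natPow (hk.comp Primrec.fst) Primrec.snd) ?_
  refine PrimrecPred.forall_lt_of (p := fun x : ((α × ℕ) × ℕ) × ℕ =>
    ¬ (c x.1.1.1).AcceptsNat (k x.1.1.1) x.1.1.2 x.1.2 x.2 ∨ (x.2 ≠ 0 ∧ x.1.2 % x.2 = 0 ∧
      (x.1.2 < k x.1.1.1 ^ ((c x.1.1.1).size + 2) * x.2 ∨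
        ∃ d < k x.1.1.1 ^ ((c x.1.1.1).size + 2), ∃ j < x.2, x.2 = d * k x.1.1.1 ^ j)))
    (Primrec.natPow (hk.comp (Primrec.fst.comp Primrec.fst)) (Primrec.snd.comp Primrec.fst)) ?_
  have hα : Primrec fun x : ((α × ℕ) × ℕ) × ℕ => x.1.1.1 :=
    Primrec.fst.comp (Primrec.fst.comp Primrec.fst)
  have hl : Primrec fun x : ((α × ℕ) × ℕ) × ℕ => x.1.1.2 :=
    Primrec.snd.comp (Primrec.fst.comp Primrec.fst)
  have hp : Primrec fun x : ((α × ℕ) × ℕ) × ℕ => x.1.2 := Primrec.snd.comp Primrec.fst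
  have hq : Primrec fun x : ((α × ℕ) × ℕ) × ℕ => x.2 := Primrec.snd
  refine (primrecPred_acceptsNat (hk.comp hα) (hc.comp hα) hl hp hq).not.or
    ((Primrec.eq.comp hq (Primrec.const 0)).not.and
      ((Primrec.eq.comp (Primrec.nat_mod.comp hp hq) (Primrec.const 0)).and
        ((Primrec.nat_lt.comp hp (Primrec.nat_mul.comp (hC.comp hα) hq)).or ?_)))
  refine PrimrecPred.exists_lt_of (p := fun y : (((α × ℕ) × ℕ) × ℕ) × ℕ =>
    ∃ j < y.1.2, y.1.2 = y.2 * k y.1.1.1.1 ^ j) (hC.comp hα) ?_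
  refine PrimrecPred.exists_lt_of (p := fun y : ((((α × ℕ) × ℕ) × ℕ) × ℕ) × ℕ =>
    y.1.1.2 = y.1.2 * k y.1.1.1.1.1 ^ y.2) (hq.comp Primrec.fst) ?_
  exact Primrec.eq.comp (hq.comp (Primrec.fst.comp Primrec.fst))
    (Primrec.nat_mul.comp (Primrec.snd.comp Primrec.fst) (Primrec.natPow
      (hk.comp (hα.comp (Primrec.fst.comp Primrec.fst))) Primrec.snd))

theorem primrecPred_valueTest {k N : α → ℕ} {c : α → DFACode} (hk : Primrec k)
    (hc : Primrec c) (hN : Primrec N) : PrimrecPred fun a => (c a).ValueTest (k a) (N a) := by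
  refine PrimrecPred.exists_lt_of (p := fun x : α × ℕ => N x.1 < k x.1 ^ x.2 ∧
      (c x.1).AcceptsNat (k x.1) x.2 0 (N x.1))
    (Primrec.nat_mul.comp (Primrec.succ.comp (primrec_size.comp hc))
      (Primrec.nat_add.comp hN (Primrec.const 2))) ?_
  have hk' := hk.comp (Primrec.fst (α := α) (β := ℕ))
  have hN' := hN.comp (Primrec.fst (α := α) (β := ℕ))
  exact (Primrec.nat_lt.comp hN' (Primrec.natPow hk' Primrec.snd)).and
    (primrecPred_acceptsNat hk' (hc.comp Primrec.fst) Primrec.snd (Primrec.const 0) hN')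

theorem primrecPred_quotientTest {k N : α → ℕ} {c : α → DFACode} (hk : Primrec k)
    (hc : Primrec c) (hN : Primrec N) : PrimrecPred fun a => (c a).QuotientTest (k a) (N a) := by
  refine PrimrecPred.exists_lt_of (p := fun x : α × ℕ => x.2 ≠ 0 ∧
      ∃ l < ((c x.1).size + 1) * ((N x.1 * x.2 + 2) * (x.2 + 2)),
        N x.1 * x.2 < k x.1 ^ l ∧ x.2 < k x.1 ^ l ∧
          (c x.1).AcceptsNat (k x.1) l (N x.1 * x.2) x.2)
    (primrec_pow_size hk hc) ?_
  refine (Primrec.eq.comp Primrec.snd (Primrec.const 0)).not.and ?_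
  have hNq : Primrec fun x : α × ℕ => N x.1 * x.2 :=
    Primrec.nat_mul.comp (hN.comp Primrec.fst) Primrec.snd
  refine PrimrecPred.exists_lt_of (p := fun x : (α × ℕ) × ℕ =>
      N x.1.1 * x.1.2 < k x.1.1 ^ x.2 ∧ x.1.2 < k x.1.1 ^ x.2 ∧
        (c x.1.1).AcceptsNat (k x.1.1) x.2 (N x.1.1 * x.1.2) x.1.2)
    (Primrec.nat_mul.comp (Primrec.succ.comp (primrec_size.comp (hc.comp Primrec.fst)))
      (Primrec.nat_mul.comp (Primrec.nat_add.comp hNq (Primrec.const 2))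
        (Primrec.nat_add.comp Primrec.snd (Primrec.const 2)))) ?_
  have hα : Primrec fun x : (α × ℕ) × ℕ => x.1.1 := Primrec.fst.comp Primrec.fst
  have hq : Primrec fun x : (α × ℕ) × ℕ => x.1.2 := Primrec.snd.comp Primrec.fst
  have hpow : Primrec fun x : (α × ℕ) × ℕ => k x.1.1 ^ x.2 :=
    Primrec.natPow (hk.comp hα) Primrec.snd
  exact (Primrec.nat_lt.comp (hNq.comp Primrec.fst) hpow).and ((Primrec.nat_lt.comp hq hpow).and
    (primrecPred_acceptsNat (hk.comp hα) (hc.comp hα) Primrec.snd (hNq.comp Primrec.fst) hq))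

theorem primrec_testBound {k : α → ℕ} {c₁ c₂ : α → DFACode} (hk : Primrec k)
    (hc₁ : Primrec c₁) (hc₂ : Primrec c₂) :
    Primrec fun a => k a ^
      profileBound ((c₁ a).size + 1) ((c₂ a).size + 1) (k a ^ ((c₁ a).size + 2)) :=
  Primrec.natPow hk (primrec_profileBound (Primrec.succ.comp (primrec_size.comp hc₁))
    (Primrec.succ.comp (primrec_size.comp hc₂)) (primrec_pow_size hk hc₁))

theorem primrecPred_subsetTest {k : α → ℕ} {c₁ c₂ : α → DFACode} (hk : Primrec k)
    (hc₁ : Primrec c₁) (hc₂ : Primrec c₂) :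
    PrimrecPred fun a => (c₁ a).SubsetTest (k a) (c₂ a) := by
  refine (primrecPred_integralTest hk hc₁).and (PrimrecPred.forall_lt_of (p := fun x : α × ℕ =>
    ¬ (c₁ x.1).QuotientTest (k x.1) x.2 ∨ (c₂ x.1).ValueTest (k x.1) x.2)
    (primrec_testBound hk hc₁ hc₂) ?_)
  have hk' := hk.comp (Primrec.fst (α := α) (β := ℕ))
  exact (primrecPred_quotientTest hk' (hc₁.comp Primrec.fst) Primrec.snd).not.or
    (primrecPred_valueTest hk' (hc₂.comp Primrec.fst) Primrec.snd)

theorem primrecPred_supsetTest {k : α → ℕ} {c₁ c₂ : α → DFACode} (hk : Primrec k)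
    (hc₁ : Primrec c₁) (hc₂ : Primrec c₂) :
    PrimrecPred fun a => (c₁ a).SupsetTest (k a) (c₂ a) := by
  refine PrimrecPred.forall_lt_of (p := fun x : α × ℕ =>
    (c₁ x.1).QuotientTest (k x.1) x.2 ∨ ¬ (c₂ x.1).ValueTest (k x.1) x.2)
    (primrec_testBound hk hc₁ hc₂) ?_
  have hk' := hk.comp (Primrec.fst (α := α) (β := ℕ))
  exact (primrecPred_quotientTest hk' (hc₁.comp Primrec.fst) Primrec.snd).or
    (primrecPred_valueTest hk' (hc₂.comp Primrec.fst) Primrec.snd).not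

end Primrec

end DFACode

/-! ### Unbounded search and the main theorem -/

/-- Codes are tried in order until one decodes to a solution; the search is total because every
input has one. -/
theorem exists_computable_choice {α β : Type} [Primcodable α] [Primcodable β]
    (p : α × β → Bool) (hp : Computable p) (h : ∀ a, ∃ b, p (a, b) = true) :
    ∃ f : α → β, Computable f ∧ ∀ a, p (a, f a) = true := by
  have hG : Computable₂ fun (a : α) (n : ℕ) =>
      (Encodable.decode (α := β) n).bind fun b => bif p (a, b) then some b else none := by
    refine Computable.option_bind (Computable.decode.comp Computable.snd) ?_
    exact Computable.cond
      (hp.comp ((Computable.fst.comp Computable.fst).pair Computable.snd))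
      (Computable.option_some.comp Computable.snd) (Computable.const none)
  have hspec : ∀ (a : α) (n : ℕ) (b : β), b ∈ ((Encodable.decode (α := β) n).bind fun b =>
      bif p (a, b) then some b else none) → p (a, b) = true := by
    intro a n b hb
    rw [Option.mem_def, Option.bind_eq_some_iff] at hb
    obtain ⟨b', -, hb'⟩ := hb
    cases hpb : p (a, b') <;> rw [hpb] at hb' <;> simp at hb'
    exact hb' ▸ hpb
  have hdom : ∀ a, (Nat.rfindOpt fun n => (Encodable.decode (α := β) n).bind fun b =>
      bif p (a, b) then some b else none).Dom := by
    intro a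
    obtain ⟨b, hb⟩ := h a
    exact Nat.rfindOpt_dom.2 ⟨Encodable.encode b, b, by simp [hb]⟩
  refine ⟨fun a => (Nat.rfindOpt _).get (hdom a),
    (Partrec.rfindOpt hG).of_eq_tot fun a => Part.get_mem (hdom a), fun a => ?_⟩
  obtain ⟨n, hn⟩ := Nat.rfindOpt_spec (Part.get_mem (hdom a))
  exact hspec a n _ hn

end AutomaticRationals

open AutomaticRationals AutomaticRationals.DFACode in
theorem mainTheorem4 :
    (∃ f : ℕ → AutomaticRationals.DFACode → Option AutomaticRationals.DFACode, Computable₂ f ∧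
      ∀ k : ℕ, 2 ≤ k → ∀ M₁ : AutomaticRationals.DFACode,
        ((f k M₁).isSome = true ↔
          AutomaticRationals.QuoDefined k (M₁.langPair k) ∧
            AutomaticRationals.quoSet k (M₁.langPair k) ⊆
              AutomaticRationals.natsInRat Set.univ) ∧
        ∀ M₂ : AutomaticRationals.DFACode, f k M₁ = some M₂ →
          AutomaticRationals.natsInRat (AutomaticRationals.valueSet k (M₂.lang k)) =
            AutomaticRationals.quoSet k (M₁.langPair k)) ∧
    (∃ g : ℕ × AutomaticRationals.DFACode × AutomaticRationals.DFACode → Bool, Computable g ∧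
      ∀ k : ℕ, 2 ≤ k → ∀ M₁ M₂ : AutomaticRationals.DFACode,
        (g (k, M₁, M₂) = true ↔
          AutomaticRationals.QuoDefined k (M₁.langPair k) ∧
            AutomaticRationals.quoSet k (M₁.langPair k) ⊆
              AutomaticRationals.natsInRat (AutomaticRationals.valueSet k (M₂.lang k)))) ∧
    (∃ g : ℕ × AutomaticRationals.DFACode × AutomaticRationals.DFACode → Bool, Computable g ∧
      ∀ k : ℕ, 2 ≤ k → ∀ M₁ M₂ : AutomaticRationals.DFACode,
        (g (k, M₁, M₂) = true ↔
          AutomaticRationals.QuoDefined k (M₁.langPair k) ∧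
            AutomaticRationals.quoSet k (M₁.langPair k) =
              AutomaticRationals.natsInRat (AutomaticRationals.valueSet k (M₂.lang k)))) ∧
    (∃ g : ℕ → AutomaticRationals.DFACode → Bool, Computable₂ g ∧
      ∀ k : ℕ, 2 ≤ k → ∀ M₁ : AutomaticRationals.DFACode,
        (g k M₁ = true ↔
          AutomaticRationals.QuoDefined k (M₁.langPair k) ∧
            AutomaticRationals.quoSet k (M₁.langPair k) =
              AutomaticRationals.natsInRat Set.univ)) := by
  classical
  have hsub : ∀ {α : Type} [Primcodable α] {k : α → ℕ} {c₁ c₂ : α → DFACode}, Primrec k →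
      Primrec c₁ → Primrec c₂ → Computable fun a => decide ((c₁ a).SubsetTest (k a) (c₂ a)) :=
    fun hk h₁ h₂ => (primrecPred_subsetTest hk h₁ h₂).decide.to_comp
  have heq : ∀ {α : Type} [Primcodable α] {k : α → ℕ} {c₁ c₂ : α → DFACode}, Primrec k →
      Primrec c₁ → Primrec c₂ → Computable fun a =>
        decide ((c₁ a).SubsetTest (k a) (c₂ a) ∧ (c₁ a).SupsetTest (k a) (c₂ a)) :=
    fun hk h₁ h₂ => ((primrecPred_subsetTest hk h₁ h₂).and
      (primrecPred_supsetTest hk h₁ h₂)).decide.to_comp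
  refine ⟨?_, ⟨fun x => decide (x.2.1.SubsetTest x.1 x.2.2), ?_, ?_⟩,
    ⟨fun x => decide (x.2.1.SubsetTest x.1 x.2.2 ∧ x.2.1.SupsetTest x.1 x.2.2), ?_, ?_⟩,
    ⟨fun k c => decide (c.SubsetTest k full ∧ c.SupsetTest k full), ?_, ?_⟩⟩
  · have hint : Computable fun x : ℕ × DFACode => decide (x.2.IntegralTest x.1) :=
      (primrecPred_integralTest Primrec.fst Primrec.snd).decide.to_comp
    -- The first two alternatives accept any output on bad inputs, so that the search halts
    -- everywhere; on good inputs the equality test selects the automaton.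
    have hp : PrimrecPred fun x : (ℕ × DFACode) × DFACode =>
        (¬ 2 ≤ x.1.1 ∨ ¬ x.1.2.IntegralTest x.1.1) ∨
          (x.1.2.SubsetTest x.1.1 x.2 ∧ x.1.2.SupsetTest x.1.1 x.2) := by
      have hk : Primrec fun x : (ℕ × DFACode) × DFACode => x.1.1 := Primrec.fst.comp Primrec.fst
      have hc : Primrec fun x : (ℕ × DFACode) × DFACode => x.1.2 := Primrec.snd.comp Primrec.fst
      exact (((Primrec.nat_le.comp (Primrec.const 2) hk).not).or
        (primrecPred_integralTest hk hc).not).or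
          ((primrecPred_subsetTest hk hc Primrec.snd).and
            (primrecPred_supsetTest hk hc Primrec.snd))
    obtain ⟨F, hF, hFspec⟩ := exists_computable_choice _ hp.decide.to_comp (by
      rintro ⟨k, c⟩
      simp only [decide_eq_true_eq]
      by_cases hk : 2 ≤ k
      · by_cases hc : c.IntegralTest k
        · have hc' := (integralTest_iff hk c).1 hc
          obtain ⟨c₂, hc₂⟩ := exists_lang_valueSet_eq_smallQuo hk
            (c.toDFA (fun a : Fin k × Fin k => (a.1 : ℕ) * k + a.2)) (k ^ (c.size + 2))
          refine ⟨c₂, Or.inr ((subsetTest_and_supsetTest_iff hk c c₂).2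
            ⟨fun w hw => (hc' w hw).1, ?_⟩)⟩
          rw [quoSet_eq_smallQuo hk c hc', hc₂]
        · exact ⟨full, Or.inl (Or.inr hc)⟩
      · exact ⟨full, Or.inl (Or.inl hk)⟩)
    refine ⟨fun k c => bif decide (c.IntegralTest k) then some (F (k, c)) else none,
      Computable.cond hint (Computable.option_some.comp hF) (Computable.const none), ?_⟩
    intro k hk c
    rw [← integral_iff, ← integralTest_iff hk]
    by_cases hc : c.IntegralTest k
    · refine ⟨by simp [hc], fun c₂ hc₂ => ?_⟩
      simp only [hc, decide_true, cond_true, Option.some.injEq] at hc₂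
      have := hFspec (k, c)
      simp only [decide_eq_true_eq, hk, hc, not_true, false_or, hc₂] at this
      exact ((subsetTest_and_supsetTest_iff hk c c₂).1 this).2.symm
    · exact ⟨by simp [hc], fun c₂ hc₂ => by simp [hc] at hc₂⟩
  · exact hsub Primrec.fst (Primrec.fst.comp Primrec.snd) (Primrec.snd.comp Primrec.snd)
  · intro k hk c₁ c₂
    rw [decide_eq_true_eq, subsetTest_iff hk]
  · exact heq Primrec.fst (Primrec.fst.comp Primrec.snd) (Primrec.snd.comp Primrec.snd)
  · intro k hk c₁ c₂
    rw [decide_eq_true_eq, subsetTest_and_supsetTest_iff hk]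
  · exact heq Primrec.fst Primrec.snd (Primrec.const full)
  · intro k hk c
    rw [decide_eq_true_eq, subsetTest_and_supsetTest_iff hk, valueSet_full hk]
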